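/- **Setting.** A network has $K$ tiers of self-powered base stations (BSs). The tier-$k$ BSs form a homogeneous Poisson point process in $\mathbb{R}^2$ of density $\lambda_k>0$, independently over the tiers; a tier-$k$ BS has transmit power $P_k>0$, a battery with capacity of $N_k\ge 1$ energy units, and harvests energy units according to a Poisson process of rate $\mu_k>0$. The received average power at distance $d$ from a tier-$k$ BS is $P_k\mathcal X_k d^{-\alpha}$, where $\alpha>0$ and the shadowing gain $\mathcal X_k>0$ is random with $\mathbb E[\mathcal X_k^{2/\alpha}]<\infty$; a user is served by the available BS from which it receives the largest average power. Users have density $\lambda_u>0$, a fraction $\mathtt{P_c}\in(0,1]$ of them (which does not depend on the availabilities) is in control channel coverage, and each of these requires one energy unit per second. If $\rho_j$ is the availability (the probability of being available) of tier $j$, the available BSs of tier $j$ form a Poisson process of density $\rho_j\lambda_j$, and $\nu_k(\rho)=\mathtt{P_c}\lambda_u\,\mathbb E|\mathcal A_k|$ is the energy utilization rate of a tier-$k$ BS, where $\mathbb E|\mathcal A_k|$ is the mean area of the service region of the typical available tier-$k$ BS. A general uncoordinated strategy turns a BS ON or OFF at every time as an arbitrary measurable, possibly randomized, nonanticipating function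 of the past of that BS alone. The energy level of a tier-$k$ BS increases by one at each energy arrival (unless it is $N_k$) and, while the BS is ON with at least one energy unit, decreases by one at rate $\nu_k(\rho)$. The BS is available when it is ON and has at least one energy unit; its availability under the strategy is $\lim_{T\to\infty}\frac1T\int_0^T\mathbb P(\text{available at time }t)\,dt$, if this limit exists. A vector $\rho\in\mathbb{R}^K$ is achieved by strategies $(S_1,\dots,S_K)$, one for each tier, if for all $k$ a tier-$k$ BS with utilization rate $\nu_k(\rho)$ has availability $\rho_k$ under $S_k$. The availability region $\mathfrak R$ is the union, over all $(S_1,\dots,S_K)$, of the sets of achieved vectors. The initial energy levels $0\le e_k\le N_k$ are arbitrary but fixed. Let $$g_k(\rho)=1-\frac{1-s_k(\rho)}{1-s_k(\rho)^{N_k+1}},\qquad s_k(\rho)=\frac{\mu_k\sum_{j=1}^K\rho_j\lambda_j\,\mathbb E[\mathcal X_j^{2/\alpha}]P_j^{2/\alpha}}{\mathtt{P_c}\lambda_u\,\mathbb E[\mathcal X_k^{2/\alpha}]P_k^{2/\alpha}},$$ where $g_k(\rho)=N_k/(N_k+1)$ (the continuous extension) if $s_k(\rho)=1$. This is the right-hand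 side of the tier-$k$ fixed-point equation of the strategy $\mathcal S_k(1)$, under which a BS serves users until its battery is empty and turns ON again once it has harvested one energy unit. **Theorem (Availability region).** 1. Let $k$ be a tier and let $\rho_j\ge 0$ for $j\ne k$. The equation $x=g_k(\rho_1,\dots,\rho_{k-1},x,\rho_{k+1},\dots,\rho_K)$ has a largest solution $x\ge 0$, denoted $\rho_k^*=\rho_k^*(\{\rho_j\}\setminus\rho_k)$; a positive solution, if there is one, is unique, and is then $\rho_k^*$. Moreover $\rho_k^*$ is the maximum availability achievable for tier $k$ given $\rho_j$, $j\ne k$: it is the largest $x$ such that, under some uncoordinated strategy, a tier-$k$ BS with utilization rate $\nu_k(\rho_1,\dots,\rho_{k-1},x,\rho_{k+1},\dots,\rho_K)$ has availability $x$. 2. The availability region for the set of general uncoordinated strategies is exactly $$\mathfrak R=\{\rho\in\mathbb R^K:\ 0\le\rho_k\le\rho_k^*(\{\rho_j\}\setminus\rho_k)\ \text{ for all } k\}.$$ If $\rho=0$, so that no BS is available, the mean service area is infinite; the zero vector is achieved by never turning ON. -/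

import Mathlib

open MeasureTheory ProbabilityTheory Filter Topology
open scoped ENNReal NNReal

namespace SelfPoweredHetNet

noncomputable section

/-! ### The network -/

/-- A `K`-tier network of self-powered base stations (BSs). Tier `k` is a homogeneous Poisson point
process in the plane; different tiers are independent. -/
structure HetNet (K : ℕ) where
  /-- density of the BSs of each tier -/
  bsDensity : Fin K → ℝ
  bsDensity_pos : ∀ k, 0 < bsDensity k
  /-- energy harvesting rate of each tier -/
  harvestRate : Fin K → ℝ
  harvestRate_pos : ∀ k, 0 < harvestRate k
  /-- battery capacity of each tier -/
  capacity : Fin K → ℕ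
  capacity_pos : ∀ k, 0 < capacity k
  /-- transmit power of each tier -/
  power : Fin K → ℝ
  power_pos : ∀ k, 0 < power k
  /-- path loss exponent -/
  pathLoss : ℝ
  pathLoss_pos : 0 < pathLoss
  /-- law of the (positive) shadowing gain of each tier -/
  shadowing : Fin K → Measure ℝ
  shadowing_prob : ∀ k, IsProbabilityMeasure (shadowing k)
  shadowing_pos : ∀ k, ∀ᵐ x ∂(shadowing k), 0 < x
  shadowing_moment : ∀ k, Integrable (fun x : ℝ => x ^ (2 / pathLoss)) (shadowing k)
  /-- density of the users -/
  userDensity : ℝ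
  userDensity_pos : 0 < userDensity
  /-- control channel coverage probability -/
  coverage : ℝ
  coverage_pos : 0 < coverage
  coverage_le_one : coverage ≤ 1

/-! ### Energy utilization rate -/

/-- The plane. -/
abbrev Plane : Type := EuclideanSpace ℝ (Fin 2)

/-- Average received power at distance `d` with transmit power `P` and shadowing gain `x`. -/
def receivedPower (P x a d : ℝ) : ℝ := P * x * d ^ (-a)

variable {K : ℕ}

/-- Mean number of available BSs of tier `j` which a user at `z` receives with more average power
than the typical tier-`k` BS, placed at the origin and having shadowing gain `x` to the user.
The available BSs of tier `j`, marked with their shadowing gains to the user, form a Poisson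
process on `Plane × ℝ` with intensity measure `ρ j * bsDensity j • (volume ⊗ shadowing j)`. -/
def meanStronger (net : HetNet K) (ρ : Fin K → ℝ) (k : Fin K) (z : Plane) (x : ℝ) (j : Fin K) :
    ℝ≥0∞ :=
  ENNReal.ofReal (ρ j * net.bsDensity j) *
    ((volume : Measure Plane).prod (net.shadowing j))
      {p | receivedPower (net.power k) x net.pathLoss ‖z‖ <
            receivedPower (net.power j) p.2 net.pathLoss ‖p.1 - z‖}

/-- Mean area of the service region of the typical available tier-`k` BS, when the available BSs of
tier `j` have density `ρ j * bsDensity j`. It is the integral over the location `z` of the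
probability that a user at `z` is served by the typical BS, i.e. that in each tier the
(Poisson distributed) number of available BSs received with more average power is zero. -/
def meanServiceArea (net : HetNet K) (ρ : Fin K → ℝ) (k : Fin K) : ℝ≥0∞ :=
  ∫⁻ z : Plane, ∫⁻ x, ∏ j, poissonMeasure (meanStronger net ρ k z x j).toNNReal {0}
    ∂(net.shadowing k)

/-- Energy utilization rate of a tier-`k` BS: mean number of covered users in its service region
(each of them requires one unit of energy per second).
If no BS is available anywhere, that is `ρ = 0`, the mean area is infinite; the value `0` which
`toReal` then gives is immaterial, since the only availability consistent with `ρ = 0` is zero. -/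
def utilizationRate (net : HetNet K) (ρ : Fin K → ℝ) (k : Fin K) : ℝ :=
  net.coverage * net.userDensity * (meanServiceArea net ρ k).toReal

/-! ### Uncoordinated strategies and the energy dynamics of one BS

Units of energy arrive at a BS as a Poisson process with rate `μ` and, independently, units of
energy are requested from it as a Poisson process with rate `ν`. The superposition of the two
processes has i.i.d. exponential gaps with rate `μ + ν`, and its points are independently marked as
arrivals (`true`) with probability `μ / (μ + ν)` and as requests (`false`) otherwise. -/

/-- Law of one point of the superposed process: the gap since the preceding point, and the mark. -/
def eventLaw (μ ν : ℝ) : Measure (ℝ × Bool) :=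
  (expMeasure (μ + ν)).prod
    (ENNReal.ofReal (μ / (μ + ν)) • Measure.dirac true +
      ENNReal.ofReal (ν / (μ + ν)) • Measure.dirac false)

theorem isProbabilityMeasure_eventLaw {μ ν : ℝ} (hμ : 0 < μ) (hν : 0 ≤ ν) :
    IsProbabilityMeasure (eventLaw μ ν) := by
  have h : 0 < μ + ν := by linarith
  have := isProbabilityMeasure_expMeasure h
  have : IsProbabilityMeasure (ENNReal.ofReal (μ / (μ + ν)) • Measure.dirac true +
      ENNReal.ofReal (ν / (μ + ν)) • Measure.dirac false : Measure Bool) := by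
    constructor
    simp only [Measure.coe_add, Measure.coe_smul, Pi.add_apply, Pi.smul_apply, measure_univ,
      smul_eq_mul, mul_one]
    rw [← ENNReal.ofReal_add (by positivity) (by positivity), ← add_div, div_self h.ne',
      ENNReal.ofReal_one]
  unfold eventLaw
  infer_instance

/-- What drives a BS: a private uniform random seed, and the sequence of all gaps and marks. -/
abbrev Input : Type := unitInterval × (ℕ → ℝ × Bool)

/-- The law of the input: the seed and the points are independent. -/
def inputLaw (μ ν : ℝ) : Measure Input :=
  (volume : Measure unitInterval).prod (Measure.infinitePi fun _ : ℕ => eventLaw μ ν)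

/-- A general uncoordinated ON/OFF strategy. `isOn n (u, past, s)` is the operational state of the
BS (`true` = ON) at the time `s` after the `n`-th point, given its seed `u` and the gaps and marks
`past` of the first `n` points. So at every time the state is an arbitrary, possibly randomized,
nonanticipating function of the BS's own past (in particular of its energy level, of elapsed times
and of timers), and of nothing else. -/
structure Strategy where
  isOn : (n : ℕ) → unitInterval × (Fin n → ℝ × Bool) × ℝ → Bool
  measurable_isOn : ∀ n, Measurable (isOn n)

/-- Time of the `n`-th point (`0` for `n = 0`, the start). -/
def eventTime (ω : Input) (n : ℕ) : ℝ := ∑ i ∈ Finset.range n, (ω.2 i).1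

/-- Operational state at the time `s` after the `n`-th point. -/
def Strategy.state (S : Strategy) (ω : Input) (n : ℕ) (s : ℝ) : Bool :=
  S.isOn n (ω.1, fun i : Fin n => ω.2 i, s)

/-- Energy level after the `n`-th point: it starts at `e₀`, increases by one at an arrival unless
the battery (of capacity `N`) is full, and decreases by one at a request which finds the BS ON and
its battery not empty. -/
def energyLevel (N e₀ : ℕ) (S : Strategy) (ω : Input) : ℕ → ℕ
  | 0 => e₀
  | n + 1 =>
    if (ω.2 n).2 = true then min (energyLevel N e₀ S ω n + 1) N
    else if S.state ω n (ω.2 n).1 = true then energyLevel N e₀ S ω n - 1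
    else energyLevel N e₀ S ω n

/-- The BS is available at time `t`: it is ON and has at least one unit of energy. -/
def AvailableAt (N e₀ : ℕ) (S : Strategy) (ω : Input) (t : ℝ) : Prop :=
  ∃ n, eventTime ω n ≤ t ∧ t < eventTime ω (n + 1) ∧
    S.state ω n (t - eventTime ω n) = true ∧ 1 ≤ energyLevel N e₀ S ω n

/-- The availability of a BS under strategy `S` exists and equals `r`: the long-run time average of
the probability that the BS is available (its long-run mean fraction of available time) is `r`. -/
def HasAvailability (μ ν : ℝ) (N e₀ : ℕ) (S : Strategy) (r : ℝ) : Prop :=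
  Tendsto (fun T : ℝ =>
      (1 / T) * ∫ t in (0 : ℝ)..T, (inputLaw μ ν).real {ω | AvailableAt N e₀ S ω t})
    atTop (𝓝 r)

/-! ### Availability region -/

/-- Tier `k` can follow a strategy under which its availability is `ρ k`, while its energy
utilization rate is the one which the availabilities `ρ` of all tiers induce. -/
def TierAchieves (net : HetNet K) (e₀ : Fin K → ℕ) (ρ : Fin K → ℝ) (k : Fin K)
    (S : Strategy) : Prop :=
  HasAvailability (net.harvestRate k) (utilizationRate net ρ k) (net.capacity k) (e₀ k) S (ρ k)

/-- The availability region: the union over all uncoordinated strategies `S` (one for each tier) of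
the sets of availability vectors that are achieved by `S`. -/
def availabilityRegion (net : HetNet K) (e₀ : Fin K → ℕ) : Set (Fin K → ℝ) :=
  ⋃ S : Fin K → Strategy, {ρ | ∀ k, TierAchieves net e₀ ρ k (S k)}

/-! ### The fixed point equations -/

/-- `w k = E[X_k ^ (2 / α)] * P_k ^ (2 / α)`, with `X_k` the shadowing gain of tier `k`. -/
def weight (net : HetNet K) (k : Fin K) : ℝ :=
  (∫ x, x ^ (2 / net.pathLoss) ∂(net.shadowing k)) * net.power k ^ (2 / net.pathLoss)

/-- `1 - (1 - s) / (1 - s ^ (N + 1))`, extended continuously to `s = 1`. -/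
def chainAvailability (N : ℕ) (s : ℝ) : ℝ :=
  if s = 1 then (N : ℝ) / (N + 1) else 1 - (1 - s) / (1 - s ^ (N + 1))

/-- The right hand side `g_k(ρ)` of the fixed point equation of tier `k`. -/
def gFun (net : HetNet K) (k : Fin K) (ρ : Fin K → ℝ) : ℝ :=
  chainAvailability (net.capacity k)
    (net.harvestRate k * (∑ j, ρ j * net.bsDensity j * weight net j) /
      (net.coverage * net.userDensity * weight net k))

/-- The nonnegative solutions `x` of `x = g_k(ρ_1, …, x, …, ρ_K)` (with `x` in position `k`). -/
def tierSolutions (net : HetNet K) (k : Fin K) (ρ : Fin K → ℝ) : Set ℝ :=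
  {x | 0 ≤ x ∧ x = gFun net k (Function.update ρ k x)}

/-- `ρ_k^*`: the largest solution of the tier-`k` fixed point equation, given the availabilities of
the other tiers. (It does not depend on the coordinate `ρ k`.) -/
def rhoStar (net : HetNet K) (k : Fin K) (ρ : Fin K → ℝ) : ℝ := sSup (tierSolutions net k ρ)

end

end SelfPoweredHetNet

namespace SelfPoweredHetNet

/-! ### The fixed point equations -/

/-! The problem decouples into geometry, control of a single BS, and a scalar fixed-point problem.

Geometry: by Poisson void probabilities and a Gaussian integral, the mean service area of tier `k`
is `weight net k / loadSum net ρ` (`meanServiceArea_eq`). Hence `g_k(ρ)` is `A(μ/ν)`, with `ν` the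
induced utilization rate and `A(s) = chainAvailability N s`, the stationary probability of a
nonempty battery when the BS is always ON (`gFun_eq`).

One BS: for fixed positive `μ` and `ν`, the achievable availabilities are exactly `[0, A(μ/ν)]`. The
upper bound is a dynamic programming argument. A solution `valueFun` of the Poisson equation of the
always-ON chain has increments decreasing in the energy level, so being OFF never pays: given the
past, the mean available time in one gap plus the change of value is at most `A/(μ+ν)`, with
equality when always ON (`integral_gapReward_le`, `integral_gapReward_of_isOn`). Summing over gaps
telescopes, the value function is bounded, and the L¹ law of large numbers for the gaps turns a
count of points into elapsed time (`HasAvailability.le`, `hasAvailability_of_isOn`). Smaller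
availabilities come from deciding once, by the seed, whether to be always ON or never ON.

Fixed point: a tier can therefore achieve `ρ k` iff `ρ k ≤ g_k(ρ)` (`exists_tierAchieves_iff`).
Since `A(s)/s` is strictly decreasing and `A < 1`, this is the same as `ρ k ≤ rhoStar net k ρ`
(`le_rhoStar_iff`), which yields both claims. -/

theorem geomSum_succ_pos {s : ℝ} (hs : 0 ≤ s) (N : ℕ) :
    0 < ∑ i ∈ Finset.range (N + 1), s ^ i := by
  rw [geom_sum_succ]
  have : 0 ≤ ∑ i ∈ Finset.range N, s ^ i := Finset.sum_nonneg fun i _ => pow_nonneg hs i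
  positivity

/-- The geometric sum absorbs the case `s = 1`. Its inverse is the stationary probability of an
empty battery in the birth–death chain on `{0, …, N}` with ratio `s`. -/
theorem chainAvailability_eq_one_sub_inv {s : ℝ} (hs : 0 ≤ s) (N : ℕ) :
    chainAvailability N s = 1 - (∑ i ∈ Finset.range (N + 1), s ^ i)⁻¹ := by
  unfold chainAvailability
  split_ifs with h
  · subst h
    have : (N : ℝ) + 1 ≠ 0 := by positivity
    simp only [one_pow, Finset.sum_const, Finset.card_range, nsmul_eq_mul, mul_one]
    push_cast
    field_simp
    ring
  · rw [geom_sum_eq h, inv_div, ← neg_sub s 1, ← neg_sub (s ^ (N + 1)) 1, neg_div_neg_eq]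

theorem chainAvailability_eq_div {s : ℝ} (hs : 0 ≤ s) (N : ℕ) :
    chainAvailability N s =
      s * (∑ i ∈ Finset.range N, s ^ i) / ∑ i ∈ Finset.range (N + 1), s ^ i := by
  have h := geomSum_succ_pos hs N
  rw [chainAvailability_eq_one_sub_inv hs]
  field_simp
  rw [geom_sum_succ]
  ring

theorem chainAvailability_nonneg {s : ℝ} (hs : 0 ≤ s) (N : ℕ) : 0 ≤ chainAvailability N s := by
  rw [chainAvailability_eq_div hs]
  have : 0 ≤ ∑ i ∈ Finset.range N, s ^ i := Finset.sum_nonneg fun i _ => pow_nonneg hs i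
  have := geomSum_succ_pos hs N
  positivity

theorem chainAvailability_pos {s : ℝ} (hs : 0 < s) {N : ℕ} (hN : 0 < N) :
    0 < chainAvailability N s := by
  rw [chainAvailability_eq_div hs.le]
  have h := geomSum_succ_pos hs.le N
  obtain ⟨M, rfl⟩ := Nat.exists_eq_succ_of_ne_zero hN.ne'
  have := geomSum_succ_pos hs.le M
  positivity

theorem chainAvailability_lt_one {s : ℝ} (hs : 0 ≤ s) (N : ℕ) : chainAvailability N s < 1 := by
  rw [chainAvailability_eq_one_sub_inv hs]
  have := inv_pos.2 (geomSum_succ_pos hs N)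
  linarith

theorem chainAvailability_zero (N : ℕ) : chainAvailability N 0 = 0 := by
  simp [chainAvailability]

theorem continuousOn_chainAvailability (N : ℕ) :
    ContinuousOn (chainAvailability N) (Set.Ici 0) := by
  have : ContinuousOn (fun s : ℝ => 1 - (∑ i ∈ Finset.range (N + 1), s ^ i)⁻¹) (Set.Ici 0) := by
    refine continuousOn_const.sub (ContinuousOn.inv₀ (by fun_prop) ?_)
    intro s hs
    exact (geomSum_succ_pos hs N).ne'
  exact this.congr fun s hs => chainAvailability_eq_one_sub_inv hs N

/-- `chainAvailability N s / s` is strictly decreasing in `s`. -/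
theorem mul_chainAvailability_lt {s t : ℝ} (hs : 0 < s) (hst : s < t) {N : ℕ} (hN : 0 < N) :
    s * chainAvailability N t < t * chainAvailability N s := by
  have ht : 0 < t := hs.trans hst
  -- Termwise, `s ^ (i - N)` is decreasing in `s` for `i < N`; this is that fact with denominators
  -- cleared.
  have h : (∑ i ∈ Finset.range N, t ^ i) * s ^ N < (∑ i ∈ Finset.range N, s ^ i) * t ^ N := by
    rw [Finset.sum_mul, Finset.sum_mul]
    refine Finset.sum_lt_sum_of_nonempty (by simpa using hN.ne') fun i hi => ?_
    have hi : i < N := Finset.mem_range.1 hi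
    obtain ⟨d, rfl⟩ := Nat.exists_eq_add_of_lt hi
    have : s ^ (d + 1) < t ^ (d + 1) := pow_lt_pow_left₀ hst hs.le (by simp)
    calc t ^ i * s ^ (i + d + 1) = (t ^ i * s ^ i) * s ^ (d + 1) := by ring
      _ < (t ^ i * s ^ i) * t ^ (d + 1) := by gcongr
      _ = _ := by ring
  have h1 := geomSum_succ_pos hs.le N
  have h2 := geomSum_succ_pos ht.le N
  rw [chainAvailability_eq_div hs.le, chainAvailability_eq_div ht.le, mul_div_assoc',
    mul_div_assoc', div_lt_div_iff₀ h2 h1]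
  -- With the top powers split off, the products of the two sums cancel and `s * t` times `h`
  -- remains.
  rw [Finset.sum_range_succ, Finset.sum_range_succ]
  have := mul_lt_mul_of_pos_left h (mul_pos hs ht)
  linarith

/-! ### Scalar fixed points of `x ↦ chainAvailability N (a + c * x)` -/

section FixedPoint

variable {N : ℕ} {a c : ℝ}

/-- For `s = a + c * x`, both `A(s)/s` and `s/x = a/x + c` are nonincreasing in `x > 0`, hence so is
`A(s)/x`. This ratio is `1` at `y`, so it is at least `1` to the left of `y`. -/
theorem le_chainAvailability_of_le_fixedPoint (hN : 0 < N) (ha : 0 ≤ a) (hc : 0 < c) {x y : ℝ}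
    (hx : 0 ≤ x) (hxy : x ≤ y) (hy : y = chainAvailability N (a + c * y)) :
    x ≤ chainAvailability N (a + c * x) := by
  rcases hx.eq_or_lt with rfl | hx
  · exact chainAvailability_nonneg (by simpa) N
  rcases hxy.eq_or_lt with rfl | hxy
  · exact hy.le
  have hs : 0 < a + c * x := by positivity
  have hst : a + c * x < a + c * y := by gcongr
  have h := mul_chainAvailability_lt hs hst hN
  rw [← hy] at h
  have : x * (a + c * y) ≤ (a + c * x) * y := by nlinarith
  nlinarith

/-- The strictly decreasing ratio `A(a + c * x)/x` cannot equal `1` twice. Positivity matters: if `a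
= 0`, then `0` is a solution as well. -/
theorem fixedPoint_unique (hN : 0 < N) (ha : 0 ≤ a) (hc : 0 < c) {x y : ℝ}
    (hx : 0 < x) (hxy : x < y) (hx' : x = chainAvailability N (a + c * x))
    (hy : y = chainAvailability N (a + c * y)) : False := by
  have hs : 0 < a + c * x := by positivity
  have hst : a + c * x < a + c * y := by gcongr
  have h := mul_chainAvailability_lt hs hst hN
  rw [← hy, ← hx'] at h
  nlinarith

/-- Intermediate value theorem on `[x, 1]`: the right end lies above the graph because
availabilities are below `1`. -/
theorem exists_fixedPoint_ge (ha : 0 ≤ a) (hc : 0 < c) {x : ℝ} (hx : 0 ≤ x)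
    (hxg : x ≤ chainAvailability N (a + c * x)) :
    ∃ y, x ≤ y ∧ y = chainAvailability N (a + c * y) := by
  have hx1 : x ≤ 1 := hxg.trans (chainAvailability_lt_one (by positivity) N).le
  have hcont : ContinuousOn (fun y => chainAvailability N (a + c * y) - y) (Set.Icc x 1) := by
    refine ContinuousOn.sub ((continuousOn_chainAvailability N).comp (by fun_prop) ?_)
      continuousOn_id
    intro y hy
    have : 0 ≤ y := hx.trans hy.1
    exact Set.mem_Ici.2 (by positivity)
  have h1 : chainAvailability N (a + c * 1) - 1 ≤ 0 := by
    have := chainAvailability_lt_one (show 0 ≤ a + c * 1 by positivity) N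
    linarith
  obtain ⟨y, hy, hy0⟩ := intermediate_value_Icc' hx1 hcont ⟨h1, sub_nonneg.2 hxg⟩
  exact ⟨y, hy.1, (sub_eq_zero.1 hy0).symm⟩

theorem exists_isGreatest_fixedPoint (hN : 0 < N) (ha : 0 ≤ a) (hc : 0 < c) :
    ∃ y, IsGreatest {x | 0 ≤ x ∧ x = chainAvailability N (a + c * x)} y ∧
      ∀ x, 0 ≤ x → 0 < x → x = chainAvailability N (a + c * x) → x = y := by
  by_cases h : ∃ y, 0 < y ∧ y = chainAvailability N (a + c * y)
  · obtain ⟨y, hy, hyg⟩ := h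
    have key : ∀ x, 0 < x → x = chainAvailability N (a + c * x) → x = y := by
      intro x hx hxg
      rcases lt_trichotomy x y with h | h | h
      · exact (fixedPoint_unique hN ha hc hx h hxg hyg).elim
      · exact h
      · exact (fixedPoint_unique hN ha hc hy h hyg hxg).elim
    refine ⟨y, ⟨⟨hy.le, hyg⟩, ?_⟩, fun x _ => key x⟩
    rintro x ⟨hx, hxg⟩
    rcases hx.eq_or_lt with rfl | hx
    · exact hy.le
    · exact (key x hx hxg).le
  · push Not at h
    -- Starting from `0` there is a nonnegative solution; as none is positive, it is `0`, and the
    -- solution set is not empty.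
    obtain ⟨y, hy, hyg⟩ := exists_fixedPoint_ge (N := N) ha hc le_rfl
      (chainAvailability_nonneg (by simpa) N)
    have : y = 0 := le_antisymm (not_lt.1 fun hy' => h y hy' hyg) hy
    subst this
    refine ⟨0, ⟨⟨le_rfl, hyg⟩, ?_⟩, fun x _ hx hxg => (h x hx hxg).elim⟩
    rintro x ⟨hx, hxg⟩
    exact not_lt.1 fun hx' => h x hx' hxg

end FixedPoint

/-! ### Weighted loads and the largest solution for each tier -/

variable {K : ℕ} (net : HetNet K)

theorem weight_pos (k : Fin K) : 0 < weight net k := by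
  have := net.shadowing_prob k
  refine mul_pos ?_ (Real.rpow_pos_of_pos (net.power_pos k) _)
  have h0 : 0 ≤ᵐ[net.shadowing k] fun x : ℝ => x ^ (2 / net.pathLoss) := by
    filter_upwards [net.shadowing_pos k] with x hx using (Real.rpow_pos_of_pos hx _).le
  rw [integral_pos_iff_support_of_nonneg_ae h0 (net.shadowing_moment k)]
  have h1 : ∀ᵐ x ∂(net.shadowing k),
      x ∈ Function.support fun x : ℝ => x ^ (2 / net.pathLoss) := by
    filter_upwards [net.shadowing_pos k] with x hx using (Real.rpow_pos_of_pos hx _).ne'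
  have h2 : net.shadowing k (Function.support fun x : ℝ => x ^ (2 / net.pathLoss)) = 1 :=
    (mem_ae_iff_prob_eq_one₀ (by
      have hm : Measurable fun x : ℝ => x ^ (2 / net.pathLoss) := by fun_prop
      exact (measurableSet_support hm).nullMeasurableSet)).1 h1
  rw [h2]
  exact one_pos

/-- The total weighted density `∑ j, ρ j * bsDensity j * weight j` of available BSs. -/
noncomputable def loadSum (ρ : Fin K → ℝ) : ℝ := ∑ j, ρ j * net.bsDensity j * weight net j

theorem loadSum_nonneg {ρ : Fin K → ℝ} (hρ : ∀ j, 0 ≤ ρ j) : 0 ≤ loadSum net ρ :=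
  Finset.sum_nonneg fun j _ =>
    mul_nonneg (mul_nonneg (hρ j) (net.bsDensity_pos j).le) (weight_pos net j).le

theorem loadSum_pos {ρ : Fin K → ℝ} (hρ : ∀ j, 0 ≤ ρ j) {k : Fin K} (hk : 0 < ρ k) :
    0 < loadSum net ρ :=
  Finset.sum_pos' (fun j _ =>
      mul_nonneg (mul_nonneg (hρ j) (net.bsDensity_pos j).le) (weight_pos net j).le)
    ⟨k, Finset.mem_univ k, mul_pos (mul_pos hk (net.bsDensity_pos k)) (weight_pos net k)⟩

theorem loadSum_update (ρ : Fin K → ℝ) (k : Fin K) (x : ℝ) :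
    loadSum net (Function.update ρ k x) =
      loadSum net (Function.update ρ k 0) + x * net.bsDensity k * weight net k := by
  have h : ∀ y, loadSum net (Function.update ρ k y) = y * net.bsDensity k * weight net k +
      ∑ j ∈ Finset.univ.erase k, ρ j * net.bsDensity j * weight net j := by
    intro y
    rw [loadSum, ← Finset.add_sum_erase _ _ (Finset.mem_univ k), Function.update_self]
    congr 1
    refine Finset.sum_congr rfl fun j hj => ?_
    rw [Function.update_of_ne (Finset.ne_of_mem_erase hj)]
  rw [h, h]
  ring

theorem update_nonneg {ρ : Fin K → ℝ} {k : Fin K} (hρ : ∀ j, j ≠ k → 0 ≤ ρ j) {x : ℝ}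
    (hx : 0 ≤ x) (j : Fin K) : 0 ≤ Function.update ρ k x j := by
  by_cases h : j = k
  · subst h; simpa
  · simpa [h] using hρ j h

/-- In its own availability, the tier-`k` fixed point equation is an equation for a function
`x ↦ chainAvailability N (a + c * x)`. -/
theorem exists_gFun_update {ρ : Fin K → ℝ} {k : Fin K} (hρ : ∀ j, j ≠ k → 0 ≤ ρ j) :
    ∃ a c : ℝ, 0 ≤ a ∧ 0 < c ∧ ∀ x, gFun net k (Function.update ρ k x) =
      chainAvailability (net.capacity k) (a + c * x) := by
  have hw := weight_pos net k
  have hD : 0 < net.coverage * net.userDensity * weight net k :=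
    mul_pos (mul_pos net.coverage_pos net.userDensity_pos) hw
  have hμ := net.harvestRate_pos k
  have hl := net.bsDensity_pos k
  refine ⟨net.harvestRate k * loadSum net (Function.update ρ k 0) /
      (net.coverage * net.userDensity * weight net k),
    net.harvestRate k * (net.bsDensity k * weight net k) /
      (net.coverage * net.userDensity * weight net k), ?_, by positivity, fun x => ?_⟩
  · have := loadSum_nonneg net (update_nonneg hρ le_rfl)
    positivity
  · have h : gFun net k (Function.update ρ k x) = chainAvailability (net.capacity k)
        (net.harvestRate k * loadSum net (Function.update ρ k x) /
          (net.coverage * net.userDensity * weight net k)) := rfl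
    rw [h, loadSum_update]
    congr 1
    ring

theorem isGreatest_rhoStar {ρ : Fin K → ℝ} {k : Fin K} (hρ : ∀ j, j ≠ k → 0 ≤ ρ j) :
    IsGreatest (tierSolutions net k ρ) (rhoStar net k ρ) ∧
      ∀ x ∈ tierSolutions net k ρ, 0 < x → x = rhoStar net k ρ := by
  obtain ⟨a, c, ha, hc, h⟩ := exists_gFun_update net hρ
  obtain ⟨y, hy, hu⟩ := exists_isGreatest_fixedPoint (net.capacity_pos k) ha hc
  have hset : tierSolutions net k ρ =
      {x | 0 ≤ x ∧ x = chainAvailability (net.capacity k) (a + c * x)} := by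
    simp only [tierSolutions, h]
  have hr : rhoStar net k ρ = y := by rw [rhoStar, hset, hy.csSup_eq]
  rw [hr, hset]
  exact ⟨hy, fun x hx hx0 => hu x hx.1 hx0 hx.2⟩

/-- The right side is what the one-BS analysis delivers, as `x` itself enters the utilization rate.
Forwards, the ratio argument applies below the fixed point; backwards, a solution exists above `x`,
and `rhoStar` bounds it. -/
theorem le_rhoStar_iff {ρ : Fin K → ℝ} {k : Fin K} (hρ : ∀ j, j ≠ k → 0 ≤ ρ j) {x : ℝ}
    (hx : 0 ≤ x) : x ≤ rhoStar net k ρ ↔ x ≤ gFun net k (Function.update ρ k x) := by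
  obtain ⟨a, c, ha, hc, h⟩ := exists_gFun_update net hρ
  obtain ⟨hmem, hub⟩ := (isGreatest_rhoStar net hρ).1
  rw [h]
  constructor
  · intro hxr
    refine le_chainAvailability_of_le_fixedPoint (net.capacity_pos k) ha hc hx hxr ?_
    rw [← h]
    exact hmem.2
  · intro hxg
    obtain ⟨y, hxy, hy⟩ := exists_fixedPoint_ge ha hc hx hxg
    refine hxy.trans (hub ⟨hx.trans hxy, ?_⟩)
    rw [h]
    exact hy

end SelfPoweredHetNet

namespace SelfPoweredHetNet

/-! ### The mean service area -/

theorem poissonMeasure_toNNReal_ofReal_zero {m : ℝ} (hm : 0 ≤ m) :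
    poissonMeasure (ENNReal.ofReal m).toNNReal {0} = ENNReal.ofReal (Real.exp (-m)) := by
  rw [poissonMeasure_singleton]
  simp only [pow_zero, mul_one, Nat.factorial_zero, Nat.cast_one, div_one]
  congr 3
  exact Real.coe_toNNReal m hm

theorem receivedPower_lt_iff {P x a d P' x' d' : ℝ} (ha : 0 < a) (hP : 0 < P) (hx : 0 < x)
    (hP' : 0 < P') (hx' : 0 < x') (hd : 0 < d) (hd' : 0 < d') :
    receivedPower P x a d < receivedPower P' x' a d' ↔
      d' < (P' * x' / (P * x)) ^ (1 / a) * d := by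
  have hA : 0 < P * x := by positivity
  have hB : 0 < P' * x' := by positivity
  rw [← Real.rpow_lt_rpow_iff hd'.le (by positivity) ha, Real.mul_rpow (by positivity) hd.le,
    ← Real.rpow_mul (by positivity), one_div_mul_cancel ha.ne', Real.rpow_one, receivedPower,
    receivedPower, Real.rpow_neg hd.le, Real.rpow_neg hd'.le, ← div_eq_mul_inv, ← div_eq_mul_inv,
    div_lt_div_iff₀ (by positivity) (by positivity), div_mul_eq_mul_div, lt_div_iff₀ hA,
    mul_comm (d' ^ a)]

/-- Area of the region in which an interfering BS is received with more average power. -/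
theorem volume_receivedPower_lt {P x a P' x' : ℝ} {z : Plane} (ha : 0 < a) (hP : 0 < P)
    (hx : 0 < x) (hP' : 0 < P') (hx' : 0 < x') (hz : z ≠ 0) :
    volume {y : Plane | receivedPower P x a ‖z‖ < receivedPower P' x' a ‖y - z‖} =
      ENNReal.ofReal (Real.pi * ‖z‖ ^ 2 / (P * x) ^ (2 / a) * P' ^ (2 / a) * x' ^ (2 / a)) := by
  have hd : 0 < ‖z‖ := norm_pos_iff.2 hz
  have hset : {y : Plane | receivedPower P x a ‖z‖ < receivedPower P' x' a ‖y - z‖} =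
      -- The centre drops out because `0 ^ (-a) = 0` by convention, so the received power at
      -- distance zero is `0`; a single point has no area.
      Metric.ball z ((P' * x' / (P * x)) ^ (1 / a) * ‖z‖) \ {z} := by
    ext y
    simp only [Set.mem_ofPred_eq, Set.mem_sdiff, Metric.mem_ball, Set.mem_singleton_iff, dist_eq_norm]
    by_cases hy : y = z
    · subst hy
      have : 0 ≤ receivedPower P x a ‖y‖ := by unfold receivedPower; positivity
      simpa [receivedPower, Real.zero_rpow (neg_ne_zero.2 ha.ne')] using this
    · rw [receivedPower_lt_iff ha hP hx hP' hx' hd (norm_pos_iff.2 (sub_ne_zero.2 hy))]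
      simp [hy]
  rw [hset, measure_sdiff_null (measure_singleton z), EuclideanSpace.volume_ball_fin_two,
    ← ENNReal.ofReal_pow (by positivity), ← ENNReal.ofReal_mul (by positivity)]
  congr 1
  have h2 : ((P' * x' / (P * x)) ^ (1 / a)) ^ 2 = (P' * x' / (P * x)) ^ (2 / a) := by
    rw [← Real.rpow_natCast, ← Real.rpow_mul (by positivity)]
    congr 1
    push_cast
    ring
  rw [mul_pow, h2, Real.div_rpow (by positivity) (by positivity),
    Real.mul_rpow hP'.le hx'.le]
  ring

theorem lintegral_exp_neg_mul_norm_sq {b : ℝ} (hb : 0 < b) :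
    ∫⁻ z : Plane, ENNReal.ofReal (Real.exp (-(b * ‖z‖ ^ 2))) = ENNReal.ofReal (Real.pi / b) := by
  have h := GaussianFourier.integral_rexp_neg_mul_sq_norm (V := Plane) hb
  have hfin : ((Module.finrank ℝ Plane : ℝ) / 2) = 1 := by simp
  rw [hfin, Real.rpow_one] at h
  -- Integrability is read off from the value: a nonintegrable function would have integral `0`.
  have hint : Integrable fun z : Plane => Real.exp (-b * ‖z‖ ^ 2) := by
    by_contra hcon
    rw [integral_undef hcon] at h
    have : 0 < Real.pi / b := by positivity
    exact this.ne h
  rw [← h, ofReal_integral_eq_lintegral_ofReal hint (ae_of_all _ fun _ => (Real.exp_pos _).le)]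
  simp only [neg_mul]

variable {K : ℕ} (net : HetNet K)

/-- Slicing at a fixed gain `x'` of the interferer leaves a punctured disc of area proportional to
`x' ^ (2 / α)`; averaging over `x'` produces `weight net j`. -/
theorem meanStronger_eq {ρ : Fin K → ℝ} (hρ : ∀ j, 0 ≤ ρ j) (k : Fin K) {z : Plane} (hz : z ≠ 0)
    {x : ℝ} (hx : 0 < x) (j : Fin K) :
    meanStronger net ρ k z x j = ENNReal.ofReal
      (Real.pi / (net.power k * x) ^ (2 / net.pathLoss) *
        (ρ j * net.bsDensity j * weight net j) * ‖z‖ ^ 2) := by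
  have := net.shadowing_prob j
  have hα := net.pathLoss_pos
  have hk := net.power_pos k
  have hj := net.power_pos j
  have hl := net.bsDensity_pos j
  have hρj := hρ j
  have hmeas : MeasurableSet {p : Plane × ℝ | receivedPower (net.power k) x net.pathLoss ‖z‖ <
      receivedPower (net.power j) p.2 net.pathLoss ‖p.1 - z‖} := by
    refine measurableSet_lt measurable_const ?_
    unfold receivedPower
    fun_prop
  have hsec : ∀ᵐ x' ∂(net.shadowing j),
      volume ((fun y : Plane => (y, x')) ⁻¹'
        {p : Plane × ℝ | receivedPower (net.power k) x net.pathLoss ‖z‖ <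
          receivedPower (net.power j) p.2 net.pathLoss ‖p.1 - z‖}) =
      ENNReal.ofReal (Real.pi * ‖z‖ ^ 2 / (net.power k * x) ^ (2 / net.pathLoss) *
        net.power j ^ (2 / net.pathLoss) * x' ^ (2 / net.pathLoss)) := by
    filter_upwards [net.shadowing_pos j] with x' hx'
    exact volume_receivedPower_lt hα hk hx hj hx' hz
  rw [meanStronger, Measure.prod_apply_symm hmeas, lintegral_congr_ae hsec,
    ← ofReal_integral_eq_lintegral_ofReal ((net.shadowing_moment j).const_mul _),
    integral_const_mul, ← ENNReal.ofReal_mul (by positivity)]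
  · congr 1
    rw [weight]
    ring
  · filter_upwards [net.shadowing_pos j] with x' hx'
    have : 0 < net.power k * x := by positivity
    simp only [Pi.zero_apply]
    positivity

theorem prod_poissonMeasure_meanStronger {ρ : Fin K → ℝ} (hρ : ∀ j, 0 ≤ ρ j) (k : Fin K)
    {z : Plane} (hz : z ≠ 0) {x : ℝ} (hx : 0 < x) :
    ∏ j, poissonMeasure (meanStronger net ρ k z x j).toNNReal {0} =
      ENNReal.ofReal (Real.exp (-(Real.pi / (net.power k * x) ^ (2 / net.pathLoss) *
        loadSum net ρ * ‖z‖ ^ 2))) := by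
  have hk := net.power_pos k
  have h : ∀ j, poissonMeasure (meanStronger net ρ k z x j).toNNReal {0} =
      ENNReal.ofReal (Real.exp (-(Real.pi / (net.power k * x) ^ (2 / net.pathLoss) *
        (ρ j * net.bsDensity j * weight net j) * ‖z‖ ^ 2))) := by
    intro j
    have hw := weight_pos net j
    have hl := net.bsDensity_pos j
    have hρj := hρ j
    rw [meanStronger_eq net hρ k hz hx j, poissonMeasure_toNNReal_ofReal_zero (by positivity)]
  simp_rw [h]
  rw [← ENNReal.ofReal_prod_of_nonneg fun _ _ => (Real.exp_pos _).le, ← Real.exp_sum]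
  congr 2
  rw [Finset.sum_neg_distrib, loadSum, Finset.mul_sum, Finset.sum_mul]

/-- After Tonelli, a fixed own gain `x` leaves a planar Gaussian integral in `z`, equal to `(P_k *
x) ^ (2 / α) / loadSum net ρ`; its mean over `x` gives the weight. -/
theorem meanServiceArea_eq {ρ : Fin K → ℝ} (hρ : ∀ j, 0 ≤ ρ j) (hL : 0 < loadSum net ρ)
    (k : Fin K) :
    meanServiceArea net ρ k = ENNReal.ofReal (weight net k / loadSum net ρ) := by
  have := net.shadowing_prob k
  have hk := net.power_pos k
  set F : Plane → ℝ → ℝ≥0∞ := fun z x =>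
    ENNReal.ofReal (Real.exp (-(Real.pi / (net.power k * x) ^ (2 / net.pathLoss) *
      loadSum net ρ * ‖z‖ ^ 2))) with hF
  have h1 : meanServiceArea net ρ k = ∫⁻ z : Plane, ∫⁻ x, F z x ∂(net.shadowing k) := by
    refine lintegral_congr_ae ?_
    have hz : ∀ᵐ z : Plane, z ≠ 0 := by simp [ae_iff, measure_singleton]
    filter_upwards [hz] with z hz
    refine lintegral_congr_ae ?_
    filter_upwards [net.shadowing_pos k] with x hx
    exact prod_poissonMeasure_meanStronger net hρ k hz hx
  rw [h1, lintegral_lintegral_swap (by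
    refine Measurable.aemeasurable ?_
    simp only [hF, Function.uncurry_def]
    fun_prop)]
  have h2 : ∀ᵐ x ∂(net.shadowing k), ∫⁻ z : Plane, F z x =
      ENNReal.ofReal (net.power k ^ (2 / net.pathLoss) / loadSum net ρ *
        x ^ (2 / net.pathLoss)) := by
    filter_upwards [net.shadowing_pos k] with x hx
    have hx' : 0 < net.power k * x := by positivity
    rw [lintegral_exp_neg_mul_norm_sq (by positivity)]
    congr 1
    rw [Real.mul_rpow hk.le hx.le]
    have := Real.rpow_pos_of_pos hx (2 / net.pathLoss)
    have := Real.rpow_pos_of_pos hk (2 / net.pathLoss)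
    field_simp
  rw [lintegral_congr_ae h2,
    ← ofReal_integral_eq_lintegral_ofReal ((net.shadowing_moment k).const_mul _),
    integral_const_mul]
  · congr 1
    rw [weight]
    ring
  · filter_upwards [net.shadowing_pos k] with x hx
    simp only [Pi.zero_apply]
    positivity

theorem utilizationRate_eq {ρ : Fin K → ℝ} (hρ : ∀ j, 0 ≤ ρ j) (hL : 0 < loadSum net ρ)
    (k : Fin K) : utilizationRate net ρ k =
      net.coverage * net.userDensity * weight net k / loadSum net ρ := by
  have hw := weight_pos net k
  rw [utilizationRate, meanServiceArea_eq net hρ hL, ENNReal.toReal_ofReal (by positivity),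
    mul_div_assoc]

theorem utilizationRate_pos {ρ : Fin K → ℝ} (hρ : ∀ j, 0 ≤ ρ j) (hL : 0 < loadSum net ρ)
    (k : Fin K) : 0 < utilizationRate net ρ k := by
  have := weight_pos net k
  have := net.coverage_pos
  have := net.userDensity_pos
  rw [utilizationRate_eq net hρ hL]
  positivity

theorem gFun_eq {ρ : Fin K → ℝ} (hρ : ∀ j, 0 ≤ ρ j) (hL : 0 < loadSum net ρ) (k : Fin K) :
    gFun net k ρ =
      chainAvailability (net.capacity k) (net.harvestRate k / utilizationRate net ρ k) := by
  rw [utilizationRate_eq net hρ hL, div_div_eq_mul_div]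
  rfl

end SelfPoweredHetNet

namespace SelfPoweredHetNet

/-! ### A relative value function for the energy level -/

/-- Increments of the relative value function of the energy level under the policy which is always
ON, for harvesting rate `μ` and utilization rate `ν`. -/
noncomputable def valueIncr (μ ν : ℝ) (N i : ℕ) : ℝ :=
  (1 - chainAvailability N (μ / ν)) / ν * ∑ j ∈ Finset.range (N - i), (μ / ν) ^ j

/-- Relative value function of the energy level. -/
noncomputable def valueFun (μ ν : ℝ) (N e : ℕ) : ℝ := ∑ i ∈ Finset.range e, valueIncr μ ν N i

section Value

variable {μ ν : ℝ} {N e : ℕ}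

/-- Poisson equation at an empty battery: only an arrival can change the level, so its value gain
must supply the whole average reward. -/
theorem harvest_mul_valueIncr_zero (hμ : 0 < μ) (hν : 0 < ν) :
    μ * valueIncr μ ν N 0 = chainAvailability N (μ / ν) := by
  have hs : 0 ≤ μ / ν := by positivity
  have hG := geomSum_succ_pos hs N
  rw [valueIncr, chainAvailability_eq_one_sub_inv hs, sub_sub_cancel,
    ← chainAvailability_eq_one_sub_inv hs, chainAvailability_eq_div hs, Nat.sub_zero]
  field_simp

/-- The increments decrease in the level, since their sums have fewer nonnegative terms. This sign
is why switching OFF cannot help. -/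
theorem harvest_mul_valueIncr_le (hμ : 0 < μ) (hν : 0 < ν) :
    μ * valueIncr μ ν N e ≤ chainAvailability N (μ / ν) := by
  rw [← harvest_mul_valueIncr_zero hμ hν]
  have hs : 0 ≤ μ / ν := by positivity
  have h1 := chainAvailability_lt_one hs N
  have h2 : 0 ≤ (1 - chainAvailability N (μ / ν)) / ν := div_nonneg (by linarith) hν.le
  refine mul_le_mul_of_nonneg_left (mul_le_mul_of_nonneg_left ?_ h2) hμ.le
  exact Finset.sum_le_sum_of_subset_of_nonneg (by simp) fun i _ _ => pow_nonneg hs i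

/-- Poisson equation of the always-ON chain at level `e + 1`, where the reward rate is `1`. -/
theorem util_mul_valueIncr (hν : 0 < ν) (he : e < N) :
    ν * valueIncr μ ν N e = 1 - chainAvailability N (μ / ν) + μ * valueIncr μ ν N (e + 1) := by
  rw [valueIncr, valueIncr, show N - e = N - (e + 1) + 1 by omega, geom_sum_succ]
  field_simp
  ring

theorem valueFun_harvest (he : e ≤ N) :
    valueFun μ ν N (min (e + 1) N) - valueFun μ ν N e = valueIncr μ ν N e := by
  rcases he.eq_or_lt with rfl | he
  -- At a full battery the arrival is lost, and the increment is an empty sum.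
  · simp [valueIncr]
  · rw [min_eq_left he, valueFun, Finset.sum_range_succ, valueFun, add_sub_cancel_left]

/-- The drift of the value function plus the availability `a`, in a state with energy level `e`. -/
theorem drift_eq (hμ : 0 < μ) (hν : 0 < ν) (he : e ≤ N) {a : ℝ} (ha : e = 0 → a = 0) :
    a + μ * (valueFun μ ν N (min (e + 1) N) - valueFun μ ν N e) +
        ν * a * (valueFun μ ν N (e - 1) - valueFun μ ν N e) =
      chainAvailability N (μ / ν) - if e = 0 then 0 else
        (1 - a) * (chainAvailability N (μ / ν) - μ * valueIncr μ ν N e) := by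
  rw [valueFun_harvest he]
  rcases Nat.eq_zero_or_pos e with rfl | he0
  · rw [ha rfl, harvest_mul_valueIncr_zero hμ hν]
    simp
  · obtain ⟨d, rfl⟩ := Nat.exists_eq_succ_of_ne_zero he0.ne'
    have h : valueFun μ ν N (d.succ - 1) - valueFun μ ν N d.succ = - valueIncr μ ν N d := by
      simp [valueFun, Finset.sum_range_succ]
    rw [h, if_neg (Nat.succ_ne_zero d)]
    have := util_mul_valueIncr (μ := μ) hν (show d < N by omega)
    simp only [Nat.succ_eq_add_one] at this ⊢
    -- The deviation from the always-ON equation at level `d + 1` enters with weight `a`.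
    linear_combination (-a) * this

end Value

/-! ### Exponential gaps -/

theorem expMeasure_Ioi {β s : ℝ} (hβ : 0 < β) (hs : 0 ≤ s) :
    expMeasure β (Set.Ioi s) = ENNReal.ofReal (Real.exp (-(β * s))) := by
  have := isProbabilityMeasure_expMeasure hβ
  have h := cdf_expMeasure_eq hβ s
  rw [if_pos hs, cdf_eq_real] at h
  rw [← Set.compl_Iic, ← ofReal_measureReal, probReal_compl_eq_one_sub measurableSet_Iic, h]
  congr 1
  ring

theorem ae_nonneg_expMeasure (β : ℝ) : ∀ᵐ x ∂(expMeasure β), 0 ≤ x := by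
  have : expMeasure β {x | ¬ 0 ≤ x} = 0 := by
    have hset : {x : ℝ | ¬ 0 ≤ x} = Set.Iio 0 := by ext; simp
    rw [hset, expMeasure, gammaMeasure, withDensity_apply _ measurableSet_Iio]
    exact lintegral_gammaPDF_of_nonpos le_rfl
  exact this

/-- Mean time spent in `D` during an exponential gap. -/
theorem lintegral_volume_inter_Ico_expMeasure {β : ℝ} (hβ : 0 < β) {D : Set ℝ}
    (hD : MeasurableSet D) :
    ∫⁻ τ, volume (D ∩ Set.Ico 0 τ) ∂(expMeasure β) =
      ENNReal.ofReal (1 / β) * expMeasure β D := by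
  have := isProbabilityMeasure_expMeasure hβ
  set E : Set (ℝ × ℝ) := {p | p.2 ∈ D ∧ 0 ≤ p.2 ∧ p.2 < p.1} with hE
  have hEm : MeasurableSet E :=
    (measurable_snd hD).inter ((measurableSet_le measurable_const measurable_snd).inter
      (measurableSet_lt measurable_snd measurable_fst))
  have h1 : ∫⁻ τ, volume (D ∩ Set.Ico 0 τ) ∂(expMeasure β) =
      ((expMeasure β).prod volume) E := by
    rw [Measure.prod_apply hEm]
    rfl
  -- Key property of the exponential law: the tail `exp (-β * s)` is `1 / β` times the density at
  -- `s`, so time spent in `D` and the chance of ending in `D` are proportional.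
  have h2 : ∀ s, expMeasure β ((fun τ => (τ, s)) ⁻¹' E) =
      D.indicator (fun s => ENNReal.ofReal (1 / β) * exponentialPDF β s) s := by
    intro s
    by_cases hsD : s ∈ D
    · rw [Set.indicator_of_mem hsD]
      rcases lt_or_ge s 0 with hs | hs
      · have : (fun τ => (τ, s)) ⁻¹' E = ∅ := by
          ext τ
          simp [hE, hs]
        rw [this, exponentialPDF_of_neg hs, measure_empty, mul_zero]
      · have : (fun τ => (τ, s)) ⁻¹' E = Set.Ioi s := by
          ext τ
          simp [hE, hs, hsD]
        rw [this, expMeasure_Ioi hβ hs, exponentialPDF_of_nonneg hs,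
          ← ENNReal.ofReal_mul (by positivity)]
        congr 1
        field_simp
    · rw [Set.indicator_of_notMem hsD]
      have : (fun τ => (τ, s)) ⁻¹' E = ∅ := by
        ext τ
        simp [hE, hsD]
      rw [this, measure_empty]
  have hpdf : Measurable (exponentialPDF β) := (measurable_exponentialPDFReal β).ennreal_ofReal
  rw [h1, Measure.prod_apply_symm hEm, lintegral_congr h2, lintegral_indicator hD,
    lintegral_const_mul _ hpdf]
  congr 1
  exact (withDensity_apply _ hD).symm

theorem measurable_volume_inter_Ico {D : Set ℝ} (hD : MeasurableSet D) :
    Measurable fun τ : ℝ => volume (D ∩ Set.Ico 0 τ) := by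
  have hEm : MeasurableSet {p : ℝ × ℝ | p.2 ∈ D ∧ 0 ≤ p.2 ∧ p.2 < p.1} :=
    (measurable_snd hD).inter ((measurableSet_le measurable_const measurable_snd).inter
      (measurableSet_lt measurable_snd measurable_fst))
  exact measurable_measure_prodMk_left (ν := volume) hEm

theorem volume_inter_Ico_lt_top (D : Set ℝ) (a b : ℝ) : volume (D ∩ Set.Ico a b) < ∞ :=
  (measure_mono Set.inter_subset_right).trans_lt measure_Ico_lt_top

theorem integral_volume_inter_Ico_expMeasure {β : ℝ} (hβ : 0 < β) {D : Set ℝ}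
    (hD : MeasurableSet D) :
    ∫ τ, volume.real (D ∩ Set.Ico 0 τ) ∂(expMeasure β) = 1 / β * (expMeasure β).real D := by
  have h := integral_toReal (measurable_volume_inter_Ico hD).aemeasurable
    (ae_of_all (expMeasure β) fun τ => volume_inter_Ico_lt_top D 0 τ)
  rw [lintegral_volume_inter_Ico_expMeasure hβ hD, ENNReal.toReal_mul,
    ENNReal.toReal_ofReal (by positivity)] at h
  exact h

theorem integrable_volume_inter_Ico_expMeasure {β : ℝ} (hβ : 0 < β) {D : Set ℝ}
    (hD : MeasurableSet D) :
    Integrable (fun τ => volume.real (D ∩ Set.Ico 0 τ)) (expMeasure β) := by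
  have := isProbabilityMeasure_expMeasure hβ
  refine integrable_toReal_of_lintegral_ne_top (measurable_volume_inter_Ico hD).aemeasurable ?_
  rw [lintegral_volume_inter_Ico_expMeasure hβ hD]
  exact ENNReal.mul_ne_top ENNReal.ofReal_ne_top (measure_ne_top _ _)

theorem volume_real_univ_inter_Ico_ae_eq (β : ℝ) :
    (fun τ => volume.real (Set.univ ∩ Set.Ico 0 τ)) =ᵐ[expMeasure β] fun τ => τ := by
  filter_upwards [ae_nonneg_expMeasure β] with τ hτ
  simp [hτ]

theorem integrable_id_expMeasure {β : ℝ} (hβ : 0 < β) :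
    Integrable (fun τ : ℝ => τ) (expMeasure β) :=
  (integrable_volume_inter_Ico_expMeasure hβ MeasurableSet.univ).congr
    (volume_real_univ_inter_Ico_ae_eq β)

theorem integral_id_expMeasure {β : ℝ} (hβ : 0 < β) : ∫ τ, τ ∂(expMeasure β) = 1 / β := by
  have := isProbabilityMeasure_expMeasure hβ
  rw [← integral_congr_ae (volume_real_univ_inter_Ico_ae_eq β),
    integral_volume_inter_Ico_expMeasure hβ MeasurableSet.univ]
  simp

end SelfPoweredHetNet

namespace SelfPoweredHetNet

/-! ### The energy dynamics of one BS -/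

/-- Seed and first `n` points. -/
def past (n : ℕ) (ω : Input) : unitInterval × (Fin n → ℝ × Bool) := (ω.1, fun i => ω.2 i)

theorem measurable_past (n : ℕ) : Measurable (past n) := by
  unfold past
  fun_prop

/-- Extension of the first `n` points by trivial ones. -/
def extend (n : ℕ) (p : unitInterval × (Fin n → ℝ × Bool)) : Input :=
  (p.1, fun i => if h : i < n then p.2 ⟨i, h⟩ else (0, true))

theorem measurable_extend (n : ℕ) : Measurable (extend n) := by
  unfold extend
  refine measurable_fst.prodMk (measurable_pi_lambda _ fun i => ?_)
  by_cases h : i < n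
  · simp only [h, dite_true]
    fun_prop
  · simp only [h, dite_false]
    fun_prop

theorem past_extend (n : ℕ) (p : unitInterval × (Fin n → ℝ × Bool)) :
    past n (extend n p) = p := by
  ext i <;> simp [past, extend]

section Dynamics

variable (N e₀ : ℕ) (S : Strategy)

theorem state_eq (ω : Input) (n : ℕ) (s : ℝ) :
    S.state ω n s = S.isOn n ((past n ω).1, (past n ω).2, s) := rfl

theorem past_eq_of_le {m n : ℕ} (h : m ≤ n) {ω ω' : Input} (hp : past n ω = past n ω') :
    past m ω = past m ω' := by
  refine Prod.ext (congrArg Prod.fst hp :) (funext fun i => ?_)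
  exact congrFun (congrArg Prod.snd hp) ⟨i, i.2.trans_le h⟩

/-- Nonanticipation: it lets the level be treated as a function of `past n ω`, with arbitrary later
points. -/
theorem energyLevel_congr {n : ℕ} {ω ω' : Input} (hp : past n ω = past n ω') :
    energyLevel N e₀ S ω n = energyLevel N e₀ S ω' n := by
  induction n with
  | zero => rfl
  | succ n ih =>
    have hp' := past_eq_of_le n.le_succ hp
    have hn : ω.2 n = ω'.2 n := congrFun (congrArg Prod.snd hp) ⟨n, n.lt_succ_self⟩
    rw [energyLevel, energyLevel, ih hp', state_eq, state_eq, hp', hn]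

theorem energyLevel_extend_past (ω : Input) (n : ℕ) :
    energyLevel N e₀ S (extend n (past n ω)) n = energyLevel N e₀ S ω n :=
  energyLevel_congr N e₀ S (past_extend n _)

theorem energyLevel_le (he : e₀ ≤ N) (ω : Input) (n : ℕ) : energyLevel N e₀ S ω n ≤ N := by
  induction n with
  | zero => exact he
  | succ n ih =>
    rw [energyLevel]
    split_ifs
    · exact min_le_right _ _
    · exact (Nat.sub_le _ _).trans ih
    · exact ih

theorem measurable_state (n : ℕ) :
    Measurable fun q : Input × ℝ => S.state q.1 n q.2 := by
  have h : Measurable fun q : Input × ℝ => (q.1.1, (fun i : Fin n => q.1.2 i), q.2) := by fun_prop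
  exact (S.measurable_isOn n).comp h

theorem measurable_energyLevel (n : ℕ) : Measurable fun ω => energyLevel N e₀ S ω n := by
  induction n with
  | zero => exact measurable_const
  | succ n ih =>
    simp only [energyLevel]
    have h1 : MeasurableSet {ω : Input | (ω.2 n).2 = true} :=
      (measurable_snd.comp ((measurable_pi_apply n).comp measurable_snd))
        (measurableSet_singleton true)
    have hm : Measurable fun ω : Input => (ω, (ω.2 n).1) := by fun_prop
    have h2 : MeasurableSet {ω : Input | S.state ω n (ω.2 n).1 = true} :=
      ((measurable_state S n).comp hm) (measurableSet_singleton true)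
    exact Measurable.ite h1 ((measurable_of_countable fun e : ℕ => min (e + 1) N).comp ih)
      (Measurable.ite h2 ((measurable_of_countable fun e : ℕ => e - 1).comp ih) ih)

theorem measurable_eventTime (n : ℕ) : Measurable fun ω => eventTime ω n := by
  unfold eventTime
  fun_prop

/-- The times after the `n`-th point at which a BS would be available, were the gap long enough. -/
def onSet (n : ℕ) (p : unitInterval × (Fin n → ℝ × Bool)) : Set ℝ :=
  {s | S.isOn n (p.1, p.2, s) = true ∧ 1 ≤ energyLevel N e₀ S (extend n p) n}

theorem measurableSet_onSet_prod (n : ℕ) :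
    MeasurableSet {q : (unitInterval × (Fin n → ℝ × Bool)) × ℝ | q.2 ∈ onSet N e₀ S n q.1} := by
  have h1 : Measurable fun q : (unitInterval × (Fin n → ℝ × Bool)) × ℝ =>
      (q.1.1, q.1.2, q.2) := by fun_prop
  have h2 : Measurable fun q : (unitInterval × (Fin n → ℝ × Bool)) × ℝ =>
      energyLevel N e₀ S (extend n q.1) n :=
    (measurable_energyLevel N e₀ S n).comp ((measurable_extend n).comp measurable_fst)
  exact (((S.measurable_isOn n).comp h1) (measurableSet_singleton true)).inter
    (measurableSet_le measurable_const h2)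

theorem measurableSet_onSet (n : ℕ) (p : unitInterval × (Fin n → ℝ × Bool)) :
    MeasurableSet (onSet N e₀ S n p) :=
  measurable_prodMk_left (measurableSet_onSet_prod N e₀ S n)

theorem mem_onSet_past {ω : Input} {n : ℕ} {s : ℝ} :
    s ∈ onSet N e₀ S n (past n ω) ↔ S.state ω n s = true ∧ 1 ≤ energyLevel N e₀ S ω n := by
  change _ ∧ _ ↔ _
  rw [energyLevel_extend_past]
  rfl

/-- The set of times at which the BS is available. -/
def availSet (ω : Input) : Set ℝ := {t | AvailableAt N e₀ S ω t}

theorem measurableSet_availableAt :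
    MeasurableSet {q : Input × ℝ | AvailableAt N e₀ S q.1 q.2} := by
  have hset : {q : Input × ℝ | AvailableAt N e₀ S q.1 q.2} = ⋃ n : ℕ,
      {q : Input × ℝ | eventTime q.1 n ≤ q.2} ∩ ({q | q.2 < eventTime q.1 (n + 1)} ∩
        ({q | S.state q.1 n (q.2 - eventTime q.1 n) = true} ∩
          {q | 1 ≤ energyLevel N e₀ S q.1 n})) := by
    ext q
    simp [AvailableAt]
  rw [hset]
  refine MeasurableSet.iUnion fun n => ?_
  have hT : ∀ m, Measurable fun q : Input × ℝ => eventTime q.1 m := fun m =>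
    (measurable_eventTime m).comp measurable_fst
  have hs : Measurable fun q : Input × ℝ => (q.1, q.2 - eventTime q.1 n) :=
    measurable_fst.prodMk (measurable_snd.sub (hT n))
  refine (measurableSet_le (hT n) measurable_snd).inter
    ((measurableSet_lt measurable_snd (hT (n + 1))).inter (MeasurableSet.inter ?_ ?_))
  · exact ((measurable_state S n).comp hs) (measurableSet_singleton true)
  · exact measurableSet_le measurable_const
      ((measurable_energyLevel N e₀ S n).comp measurable_fst)

theorem measurableSet_availSet (ω : Input) : MeasurableSet (availSet N e₀ S ω) :=
  measurable_prodMk_left (measurableSet_availableAt N e₀ S)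

theorem eventTime_succ (ω : Input) (n : ℕ) :
    eventTime ω (n + 1) = eventTime ω n + (ω.2 n).1 := by
  rw [eventTime, Finset.sum_range_succ, eventTime]

theorem monotone_eventTime {ω : Input} (hω : ∀ n, 0 ≤ (ω.2 n).1) : Monotone (eventTime ω) :=
  monotone_nat_of_le_succ fun n => by
    rw [eventTime_succ]
    exact le_add_of_nonneg_right (hω n)

theorem eventTime_nonneg {ω : Input} (hω : ∀ n, 0 ≤ (ω.2 n).1) (n : ℕ) : 0 ≤ eventTime ω n :=
  Finset.sum_nonneg fun i _ => hω i

/-- With nonnegative gaps the intervals between points are disjoint, so the index in `AvailableAt`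
is forced; the rest is a translation by the time of the point. -/
theorem availSet_inter_gap {ω : Input} (hω : ∀ n, 0 ≤ (ω.2 n).1) (n : ℕ) :
    availSet N e₀ S ω ∩ Set.Ico (eventTime ω n) (eventTime ω (n + 1)) =
      (fun t => t + -eventTime ω n) ⁻¹'
        (onSet N e₀ S n (past n ω) ∩ Set.Ico 0 (ω.2 n).1) := by
  ext t
  rw [Set.mem_preimage, Set.mem_inter_iff, Set.mem_inter_iff, mem_onSet_past, Set.mem_Ico,
    Set.mem_Ico, eventTime_succ, ← sub_eq_add_neg, sub_nonneg, sub_lt_iff_lt_add']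
  refine and_congr_left fun ht => ?_
  constructor
  · rintro ⟨m, h1, h2, h3⟩
    have hmn : m = n := by
      rcases lt_trichotomy m n with h | h | h
      · exact absurd (h2.trans_le (monotone_eventTime hω h)) (not_lt.2 ht.1)
      · exact h
      · have := monotone_eventTime hω (Nat.succ_le_of_lt h)
        rw [Nat.succ_eq_add_one, eventTime_succ] at this
        exact absurd (ht.2.trans_le (this.trans h1)) (lt_irrefl _)
    subst hmn
    exact h3
  · intro h
    exact ⟨n, ht.1, by rw [eventTime_succ]; exact ht.2, h⟩

/-- Time spent available during the gap after the `n`-th point. -/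
noncomputable def gapAvail (n : ℕ) (ω : Input) : ℝ :=
  volume.real (onSet N e₀ S n (past n ω) ∩ Set.Ico 0 (ω.2 n).1)

theorem volume_real_inter_Ico_add (A : Set ℝ) {a b c : ℝ} (hab : a ≤ b) (hbc : b ≤ c) :
    volume.real (A ∩ Set.Ico a c) =
      volume.real (A ∩ Set.Ico a b) + volume.real (A ∩ Set.Ico b c) := by
  have h := measureReal_inter_add_sdiff (μ := volume) (s := A ∩ Set.Ico a c)
    (measurableSet_Iio (a := b)) (volume_inter_Ico_lt_top A a c).ne
  rw [← h]
  congr 2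
  · ext t
    simp only [Set.mem_inter_iff, Set.mem_Ico, Set.mem_Iio]
    constructor
    · rintro ⟨⟨h1, h2, h3⟩, h4⟩
      exact ⟨h1, h2, h4⟩
    · rintro ⟨h1, h2, h4⟩
      exact ⟨⟨h1, h2, h4.trans_le hbc⟩, h4⟩
  · ext t
    simp only [Set.mem_inter_iff, Set.mem_Ico, Set.mem_sdiff, Set.mem_Iio, not_lt]
    constructor
    · rintro ⟨⟨h1, h2, h3⟩, h4⟩
      exact ⟨h1, h4, h3⟩
    · rintro ⟨h1, h2, h4⟩
      exact ⟨⟨h1, hab.trans h2, h4⟩, h2⟩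

theorem volume_real_inter_Ico_le (A : Set ℝ) {a b : ℝ} (hab : a ≤ b) :
    volume.real (A ∩ Set.Ico a b) ≤ b - a := by
  have h := measureReal_mono (μ := volume) (Set.inter_subset_right (s := A) (t := Set.Ico a b))
    measure_Ico_lt_top.ne
  rwa [Real.volume_real_Ico_of_le hab] at h

theorem abs_volume_real_inter_Ico_sub_le (A : Set ℝ) {a b : ℝ} (ha : 0 ≤ a) (hb : 0 ≤ b) :
    |volume.real (A ∩ Set.Ico 0 a) - volume.real (A ∩ Set.Ico 0 b)| ≤ |a - b| := by
  rcases le_total a b with h | h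
  · rw [volume_real_inter_Ico_add A ha h, sub_add_cancel_left, abs_neg,
      abs_of_nonneg measureReal_nonneg, abs_sub_comm, abs_of_nonneg (sub_nonneg.2 h)]
    exact volume_real_inter_Ico_le A h
  · rw [volume_real_inter_Ico_add A hb h, add_sub_cancel_left,
      abs_of_nonneg measureReal_nonneg, abs_of_nonneg (sub_nonneg.2 h)]
    exact volume_real_inter_Ico_le A h

theorem volume_availSet_inter_eventTime {ω : Input} (hω : ∀ n, 0 ≤ (ω.2 n).1) (n : ℕ) :
    volume.real (availSet N e₀ S ω ∩ Set.Ico 0 (eventTime ω n)) =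
      ∑ i ∈ Finset.range n, gapAvail N e₀ S i ω := by
  induction n with
  | zero => simp [eventTime]
  | succ n ih =>
    rw [Finset.sum_range_succ, ← ih, volume_real_inter_Ico_add _ (eventTime_nonneg hω n)
      (monotone_eventTime hω n.le_succ), availSet_inter_gap N e₀ S hω n, gapAvail]
    congr 1
    rw [measureReal_def, measureReal_def, measure_preimage_add_right]

end Dynamics

/-! ### The law of the input -/

section Law

variable {μ ν : ℝ}

theorem isProbabilityMeasure_inputLaw [IsProbabilityMeasure (eventLaw μ ν)] :
    IsProbabilityMeasure (inputLaw μ ν) := by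
  unfold inputLaw
  infer_instance

theorem map_point_inputLaw [IsProbabilityMeasure (eventLaw μ ν)] (n : ℕ) :
    (inputLaw μ ν).map (fun ω => ω.2 n) = eventLaw μ ν := by
  have h : (fun ω : Input => ω.2 n) = (fun x : ℕ → ℝ × Bool => x n) ∘ Prod.snd := rfl
  rw [h, ← Measure.map_map (measurable_pi_apply n) measurable_snd, inputLaw,
    Measure.map_snd_prod, measure_univ, one_smul, Measure.infinitePi_map_eval]

/-- The next point is independent of the past. -/
theorem map_past_point_inputLaw [IsProbabilityMeasure (eventLaw μ ν)] (n : ℕ) :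
    (inputLaw μ ν).map (fun ω => (past n ω, ω.2 n)) =
      ((inputLaw μ ν).map (past n)).prod (eventLaw μ ν) := by
  set Q : Measure (ℕ → ℝ × Bool) := Measure.infinitePi fun _ : ℕ => eventLaw μ ν with hQ
  have hind : iIndepFun (fun (i : ℕ) (x : ℕ → ℝ × Bool) => x i) Q :=
    iIndepFun_infinitePi (P := fun _ : ℕ => eventLaw μ ν) (X := fun _ x => x)
      fun _ => measurable_id
  have h1 := hind.indepFun_finset (Finset.range n) {n} (by simp) fun i => measurable_pi_apply i
  have h2 : IndepFun (fun (x : ℕ → ℝ × Bool) (i : Fin n) => x i) (fun x => x n) Q := by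
    refine h1.comp (φ := fun y (i : Fin n) => y ⟨i, Finset.mem_range.2 i.2⟩)
      (ψ := fun y => y ⟨n, Finset.mem_singleton_self n⟩) ?_ ?_ <;> fun_prop
  rw [indepFun_iff_map_prod_eq_prod_map_map (Measurable.aemeasurable (by fun_prop))
    (Measurable.aemeasurable (by fun_prop)),
    Measure.infinitePi_map_eval] at h2
  set F : (ℕ → ℝ × Bool) → (Fin n → ℝ × Bool) := fun x i => x i with hF
  have hFm : Measurable F := by fun_prop
  have hp : (inputLaw μ ν).map (past n) = (volume : Measure unitInterval).prod (Q.map F) := by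
    have : past n = Prod.map id F := rfl
    rw [this, inputLaw, ← Measure.map_prod_map _ _ measurable_id hFm, Measure.map_id]
  have : IsProbabilityMeasure (Q.map F) := Measure.isProbabilityMeasure_map hFm.aemeasurable
  -- Regrouping moves the seed into the past, so that independence within the sequence suffices.
  have hcomp : (fun ω : Input => (past n ω, ω.2 n)) =
      MeasurableEquiv.prodAssoc.symm ∘ Prod.map id (fun x => (F x, x n)) := rfl
  rw [hp, hcomp, ← Measure.map_map (MeasurableEquiv.measurable _) (by fun_prop), inputLaw,
    ← Measure.map_prod_map _ _ measurable_id (by fun_prop), Measure.map_id, h2]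
  exact (measurePreserving_prodAssoc _ _ _).symm.map_eq

end Law

end SelfPoweredHetNet

namespace SelfPoweredHetNet

/-! ### Mean drift over one gap -/

/-- Law of the mark of one point of the superposed process. -/
noncomputable def markLaw (μ ν : ℝ) : Measure Bool :=
  ENNReal.ofReal (μ / (μ + ν)) • Measure.dirac true +
    ENNReal.ofReal (ν / (μ + ν)) • Measure.dirac false

section Gap

variable {μ ν : ℝ}

theorem isProbabilityMeasure_markLaw (hμ : 0 < μ) (hν : 0 < ν) :
    IsProbabilityMeasure (markLaw μ ν) := by
  constructor
  simp only [markLaw, Measure.coe_add, Measure.coe_smul, Pi.add_apply, Pi.smul_apply, measure_univ,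
    smul_eq_mul, mul_one]
  rw [← ENNReal.ofReal_add (by positivity) (by positivity), ← add_div, div_self (by positivity),
    ENNReal.ofReal_one]

theorem integral_markLaw (hμ : 0 < μ) (hν : 0 < ν) (g : Bool → ℝ) :
    ∫ m, g m ∂(markLaw μ ν) = μ / (μ + ν) * g true + ν / (μ + ν) * g false := by
  rw [markLaw, integral_add_measure, integral_smul_measure, integral_smul_measure,
    integral_dirac, integral_dirac, ENNReal.toReal_ofReal (by positivity),
    ENNReal.toReal_ofReal (by positivity), smul_eq_mul, smul_eq_mul]
  · exact (integrable_dirac (by simp)).smul_measure ENNReal.ofReal_ne_top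
  · exact (integrable_dirac (by simp)).smul_measure ENNReal.ofReal_ne_top

/-- The mean time in `D` and the chance that a request occurs in `D` carry the same factor, the
exponential mass of `D`. An arbitrary timing rule within a gap thus acts only through one number.
The integrand splits into three products of a function of the gap and one of the mark. -/
theorem integral_eventLaw (hμ : 0 < μ) (hν : 0 < ν) {D : Set ℝ} (hD : MeasurableSet D)
    (x y : ℝ) :
    ∫ z, (volume.real (D ∩ Set.Ico 0 z.1) + if z.2 = true then x else D.indicator (fun _ => y) z.1)
      ∂(eventLaw μ ν) =
    1 / (μ + ν) * ((expMeasure (μ + ν)).real D + μ * x + ν * (expMeasure (μ + ν)).real D * y) := by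
  have hβ : 0 < μ + ν := by positivity
  have := isProbabilityMeasure_expMeasure hβ
  have := isProbabilityMeasure_markLaw hμ hν
  have hfin : ∀ g : Bool → ℝ, Integrable g (markLaw μ ν) := fun g => Integrable.of_finite
  have hv := integrable_volume_inter_Ico_expMeasure hβ hD
  have h1D : Integrable (D.indicator fun _ => (1 : ℝ)) (expMeasure (μ + ν)) :=
    (integrable_const 1).indicator hD
  set g₁ : ℝ × Bool → ℝ := fun z => volume.real (D ∩ Set.Ico 0 z.1) * (fun _ => (1 : ℝ)) z.2
    with hg₁
  set g₂ : ℝ × Bool → ℝ := fun z =>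
    (fun _ => (1 : ℝ)) z.1 * (fun m => if m = true then x else 0) z.2 with hg₂
  set g₃ : ℝ × Bool → ℝ := fun z =>
    D.indicator (fun _ => (1 : ℝ)) z.1 * (fun m => if m = true then 0 else y) z.2 with hg₃
  have hsplit : ∀ z : ℝ × Bool,
      (volume.real (D ∩ Set.Ico 0 z.1) + if z.2 = true then x else D.indicator (fun _ => y) z.1) =
      g₁ z + (g₂ z + g₃ z) := by
    rintro ⟨τ, m⟩
    by_cases h : τ ∈ D <;> cases m <;> simp [h, hg₁, hg₂, hg₃]
  have he : eventLaw μ ν = (expMeasure (μ + ν)).prod (markLaw μ ν) := rfl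
  have i₁ : Integrable g₁ (eventLaw μ ν) := hv.mul_prod (hfin fun _ => 1)
  have i₂ : Integrable g₂ (eventLaw μ ν) :=
    (integrable_const 1).mul_prod (hfin fun m => if m = true then x else 0)
  have i₃ : Integrable g₃ (eventLaw μ ν) :=
    h1D.mul_prod (hfin fun m => if m = true then 0 else y)
  have e₁ : ∫ z, g₁ z ∂(eventLaw μ ν) =
      (∫ τ, volume.real (D ∩ Set.Ico 0 τ) ∂(expMeasure (μ + ν))) * ∫ _, 1 ∂(markLaw μ ν) :=
    integral_prod_mul (fun τ => volume.real (D ∩ Set.Ico 0 τ)) fun _ => (1 : ℝ)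
  have e₂ : ∫ z, g₂ z ∂(eventLaw μ ν) =
      (∫ _, 1 ∂(expMeasure (μ + ν))) * ∫ m, (if m = true then x else 0) ∂(markLaw μ ν) :=
    integral_prod_mul (fun _ => (1 : ℝ)) fun m => if m = true then x else 0
  have e₃ : ∫ z, g₃ z ∂(eventLaw μ ν) =
      (∫ τ, D.indicator (fun _ => (1 : ℝ)) τ ∂(expMeasure (μ + ν))) *
        ∫ m, (if m = true then 0 else y) ∂(markLaw μ ν) :=
    integral_prod_mul (D.indicator fun _ => (1 : ℝ)) fun m => if m = true then 0 else y
  rw [integral_congr_ae (ae_of_all _ hsplit),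
    integral_add (g := fun z => g₂ z + g₃ z) i₁ (i₂.add i₃),
    integral_add i₂ i₃, e₁, e₂, e₃,
    integral_volume_inter_Ico_expMeasure hβ hD,
    integral_markLaw hμ hν (fun m => if m = true then x else 0),
    integral_markLaw hμ hν (fun m => if m = true then 0 else y), integral_indicator_const _ hD,
    integral_const, integral_const]
  simp only [probReal_univ, smul_eq_mul, mul_one, if_true, Bool.false_eq_true, if_false]
  field_simp
  ring

theorem valueIncr_nonneg (hμ : 0 < μ) (hν : 0 < ν) (N i : ℕ) : 0 ≤ valueIncr μ ν N i := by
  have hs : 0 ≤ μ / ν := by positivity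
  have h1 := chainAvailability_lt_one hs N
  exact mul_nonneg (div_nonneg (by linarith) hν.le) (Finset.sum_nonneg fun j _ => pow_nonneg hs j)

theorem valueFun_nonneg (hμ : 0 < μ) (hν : 0 < ν) (N e : ℕ) : 0 ≤ valueFun μ ν N e :=
  Finset.sum_nonneg fun i _ => valueIncr_nonneg hμ hν N i

theorem valueFun_le (hμ : 0 < μ) (hν : 0 < ν) {N e : ℕ} (he : e ≤ N) :
    valueFun μ ν N e ≤ valueFun μ ν N N :=
  Finset.sum_le_sum_of_subset_of_nonneg (by simpa) fun i _ _ => valueIncr_nonneg hμ hν N i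

variable (N e₀ : ℕ) (S : Strategy)

theorem map_gap_inputLaw (hμ : 0 < μ) (hν : 0 < ν) (n : ℕ) :
    (inputLaw μ ν).map (fun ω => (ω.2 n).1) = expMeasure (μ + ν) := by
  have := isProbabilityMeasure_eventLaw hμ hν.le
  have := isProbabilityMeasure_expMeasure (add_pos hμ hν)
  have := isProbabilityMeasure_markLaw hμ hν
  have h : (fun ω : Input => (ω.2 n).1) = Prod.fst ∘ fun ω : Input => ω.2 n := rfl
  have he : eventLaw μ ν = (expMeasure (μ + ν)).prod (markLaw μ ν) := rfl
  rw [h, ← Measure.map_map measurable_fst (by fun_prop), map_point_inputLaw, he,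
    Measure.map_fst_prod, measure_univ, one_smul]

theorem measurable_gap (n : ℕ) : Measurable fun ω : Input => (ω.2 n).1 := by fun_prop

theorem ae_gap_nonneg (hμ : 0 < μ) (hν : 0 < ν) :
    ∀ᵐ ω ∂(inputLaw μ ν), ∀ n, 0 ≤ (ω.2 n).1 := by
  rw [ae_all_iff]
  intro n
  have h := ae_nonneg_expMeasure (μ + ν)
  rw [← map_gap_inputLaw hμ hν n] at h
  exact ae_of_ae_map (measurable_gap n).aemeasurable h

theorem integrable_gap (hμ : 0 < μ) (hν : 0 < ν) (n : ℕ) :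
    Integrable (fun ω : Input => (ω.2 n).1) (inputLaw μ ν) := by
  have h := integrable_id_expMeasure (add_pos hμ hν)
  rw [← map_gap_inputLaw hμ hν n] at h
  exact h.comp_measurable (measurable_gap n)

theorem integral_gap (hμ : 0 < μ) (hν : 0 < ν) (n : ℕ) :
    ∫ ω, (ω.2 n).1 ∂(inputLaw μ ν) = 1 / (μ + ν) := by
  have h := integral_id_expMeasure (add_pos hμ hν)
  rwa [← map_gap_inputLaw hμ hν n, integral_map (f := fun τ => τ)
    (measurable_gap n).aemeasurable measurable_id.aestronglyMeasurable] at h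

/-- Time available during a gap, plus the change of the value function, in terms of the past and
the next point. -/
noncomputable def gapReward (μ ν : ℝ) (N e₀ : ℕ) (S : Strategy) (n : ℕ)
    (q : (unitInterval × (Fin n → ℝ × Bool)) × (ℝ × Bool)) : ℝ :=
  volume.real (onSet N e₀ S n q.1 ∩ Set.Ico 0 q.2.1) +
    if q.2.2 = true then
      valueFun μ ν N (min (energyLevel N e₀ S (extend n q.1) n + 1) N) -
        valueFun μ ν N (energyLevel N e₀ S (extend n q.1) n)
    else (onSet N e₀ S n q.1).indicator
      (fun _ => valueFun μ ν N (energyLevel N e₀ S (extend n q.1) n - 1) -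
        valueFun μ ν N (energyLevel N e₀ S (extend n q.1) n)) q.2.1

theorem gapReward_past_point (n : ℕ) (ω : Input) :
    gapReward μ ν N e₀ S n (past n ω, ω.2 n) = gapAvail N e₀ S n ω +
      (valueFun μ ν N (energyLevel N e₀ S ω (n + 1)) -
        valueFun μ ν N (energyLevel N e₀ S ω n)) := by
  rw [gapReward, gapAvail, energyLevel]
  simp only [energyLevel_extend_past]
  congr 1
  by_cases hm : (ω.2 n).2 = true
  · simp [hm]
  · by_cases hs : S.state ω n (ω.2 n).1 = true
    -- On an empty battery a request is harmless since `0 - 1 = 0` in `ℕ`, so it makes no difference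
    -- that `onSet` is then empty.
    · rcases Nat.eq_zero_or_pos (energyLevel N e₀ S ω n) with he | he
      · simp [hm, hs, he]
      · rw [if_neg hm, if_neg hm, if_pos hs, Set.indicator_of_mem]
        exact (mem_onSet_past N e₀ S).2 ⟨hs, he⟩
    · rw [if_neg hm, if_neg hm, if_neg hs, Set.indicator_of_notMem, sub_self]
      exact fun h => hs ((mem_onSet_past N e₀ S).1 h).1

theorem measurable_volume_onSet_inter (n : ℕ) :
    Measurable fun q : (unitInterval × (Fin n → ℝ × Bool)) × (ℝ × Bool) =>
      volume.real (onSet N e₀ S n q.1 ∩ Set.Ico 0 q.2.1) := by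
  have hm : Measurable fun r : ((unitInterval × (Fin n → ℝ × Bool)) × (ℝ × Bool)) × ℝ =>
      (r.1.1, r.2) := by fun_prop
  have h : MeasurableSet {r : ((unitInterval × (Fin n → ℝ × Bool)) × (ℝ × Bool)) × ℝ |
      r.2 ∈ onSet N e₀ S n r.1.1 ∧ 0 ≤ r.2 ∧ r.2 < r.1.2.1} :=
    (hm (measurableSet_onSet_prod N e₀ S n)).inter
      ((measurableSet_le measurable_const measurable_snd).inter
        (measurableSet_lt measurable_snd (by fun_prop)))
  exact (measurable_measure_prodMk_left (ν := volume) h).ennreal_toReal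

theorem measurable_gapReward (n : ℕ) : Measurable (gapReward μ ν N e₀ S n) := by
  have hE : Measurable fun q : (unitInterval × (Fin n → ℝ × Bool)) × (ℝ × Bool) =>
      energyLevel N e₀ S (extend n q.1) n :=
    (measurable_energyLevel N e₀ S n).comp ((measurable_extend n).comp measurable_fst)
  have hm : Measurable fun q : (unitInterval × (Fin n → ℝ × Bool)) × (ℝ × Bool) =>
      (q.1, q.2.1) := by fun_prop
  unfold gapReward
  refine (measurable_volume_onSet_inter N e₀ S n).add (Measurable.ite ?_ ?_ ?_)
  · exact (measurable_snd.comp measurable_snd) (measurableSet_singleton true)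
  · exact (measurable_of_countable fun e : ℕ => valueFun μ ν N (min (e + 1) N) -
      valueFun μ ν N e).comp hE
  · have h2 := (measurable_of_countable fun e : ℕ => valueFun μ ν N (e - 1) -
      valueFun μ ν N e).comp hE
    exact h2.indicator (hm (measurableSet_onSet_prod N e₀ S n))

theorem measurable_gapAvail (n : ℕ) : Measurable (gapAvail N e₀ S n) :=
  (measurable_volume_onSet_inter N e₀ S n).comp
    ((measurable_past n).prodMk ((measurable_pi_apply n).comp measurable_snd))

theorem integrable_gapAvail (hμ : 0 < μ) (hν : 0 < ν) (n : ℕ) :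
    Integrable (gapAvail N e₀ S n) (inputLaw μ ν) := by
  refine (integrable_gap hμ hν n).mono' (measurable_gapAvail N e₀ S n).aestronglyMeasurable ?_
  filter_upwards [ae_gap_nonneg hμ hν] with ω hω
  rw [gapAvail, Real.norm_of_nonneg measureReal_nonneg]
  simpa using volume_real_inter_Ico_le (onSet N e₀ S n (past n ω)) (hω n)

theorem integrable_valueFun_energyLevel (hμ : 0 < μ) (hν : 0 < ν) (he : e₀ ≤ N) (n : ℕ) :
    Integrable (fun ω => valueFun μ ν N (energyLevel N e₀ S ω n)) (inputLaw μ ν) := by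
  have := isProbabilityMeasure_eventLaw hμ hν.le
  have := isProbabilityMeasure_inputLaw (μ := μ) (ν := ν)
  refine Integrable.of_bound ((measurable_of_countable (valueFun μ ν N)).comp
    (measurable_energyLevel N e₀ S n)).aestronglyMeasurable (valueFun μ ν N N)
    (ae_of_all _ fun ω => ?_)
  rw [Real.norm_of_nonneg (valueFun_nonneg hμ hν N _)]
  exact valueFun_le hμ hν (energyLevel_le N e₀ S he ω n)

/-- The mean reward of one gap is its mean length times the availability of the policy which is
always ON, minus a loss which vanishes if the BS is ON. -/
theorem integral_gapReward (hμ : 0 < μ) (hν : 0 < ν) (he : e₀ ≤ N) (n : ℕ)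
    (p : unitInterval × (Fin n → ℝ × Bool)) :
    ∫ z, gapReward μ ν N e₀ S n (p, z) ∂(eventLaw μ ν) =
      1 / (μ + ν) * (chainAvailability N (μ / ν) -
        if energyLevel N e₀ S (extend n p) n = 0 then 0 else
          (1 - (expMeasure (μ + ν)).real (onSet N e₀ S n p)) * (chainAvailability N (μ / ν) -
            μ * valueIncr μ ν N (energyLevel N e₀ S (extend n p) n))) := by
  have h := integral_eventLaw hμ hν (measurableSet_onSet N e₀ S n p)
    (valueFun μ ν N (min (energyLevel N e₀ S (extend n p) n + 1) N) -
      valueFun μ ν N (energyLevel N e₀ S (extend n p) n))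
    (valueFun μ ν N (energyLevel N e₀ S (extend n p) n - 1) -
      valueFun μ ν N (energyLevel N e₀ S (extend n p) n))
  refine h.trans ?_
  -- Here `a` is the probability that the gap ends in `onSet`; it has to vanish at level zero.
  rw [drift_eq hμ hν (energyLevel_le N e₀ S he _ n)]
  intro h0
  have : onSet N e₀ S n p = ∅ := by
    ext s
    simp [onSet, h0]
  rw [this, measureReal_empty]

theorem integral_gapReward_le (hμ : 0 < μ) (hν : 0 < ν) (he : e₀ ≤ N) (n : ℕ)
    (p : unitInterval × (Fin n → ℝ × Bool)) :
    ∫ z, gapReward μ ν N e₀ S n (p, z) ∂(eventLaw μ ν) ≤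
      chainAvailability N (μ / ν) / (μ + ν) := by
  have := isProbabilityMeasure_expMeasure (add_pos hμ hν)
  rw [integral_gapReward N e₀ S hμ hν he, div_eq_mul_one_div (chainAvailability _ _),
    mul_comm (1 / (μ + ν))]
  refine mul_le_mul_of_nonneg_right (sub_le_self _ ?_) (by positivity)
  split_ifs
  · exact le_rfl
  · exact mul_nonneg (sub_nonneg.2 measureReal_le_one)
      (sub_nonneg.2 (harvest_mul_valueIncr_le hμ hν))

theorem integral_gapReward_of_isOn (hμ : 0 < μ) (hν : 0 < ν) (he : e₀ ≤ N)
    (hS : ∀ n q, S.isOn n q = true) (n : ℕ) (p : unitInterval × (Fin n → ℝ × Bool)) :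
    ∫ z, gapReward μ ν N e₀ S n (p, z) ∂(eventLaw μ ν) =
      chainAvailability N (μ / ν) / (μ + ν) := by
  have := isProbabilityMeasure_expMeasure (add_pos hμ hν)
  rw [integral_gapReward N e₀ S hμ hν he, div_eq_mul_one_div (chainAvailability _ _),
    mul_comm (1 / (μ + ν))]
  congr 1
  split_ifs with h
  · exact sub_zero _
  · have : onSet N e₀ S n p = Set.univ := by
      ext s
      simpa [onSet, hS] using Nat.one_le_iff_ne_zero.2 h
    rw [this, probReal_univ, sub_self, zero_mul, sub_zero]

/-- `Q` is the law of the past. Independence of the next point makes the inner integral the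
conditional mean reward, so pointwise bounds on it transfer to the mean. -/
theorem integral_gapAvail_add (hμ : 0 < μ) (hν : 0 < ν) (he : e₀ ≤ N) (n : ℕ) :
    ∃ Q : Measure (unitInterval × (Fin n → ℝ × Bool)), IsProbabilityMeasure Q ∧
      Integrable (fun p => ∫ z, gapReward μ ν N e₀ S n (p, z) ∂(eventLaw μ ν)) Q ∧
      ∫ ω, gapAvail N e₀ S n ω ∂(inputLaw μ ν) +
        (∫ ω, valueFun μ ν N (energyLevel N e₀ S ω (n + 1)) ∂(inputLaw μ ν) -
          ∫ ω, valueFun μ ν N (energyLevel N e₀ S ω n) ∂(inputLaw μ ν)) =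
      ∫ p, ∫ z, gapReward μ ν N e₀ S n (p, z) ∂(eventLaw μ ν) ∂Q := by
  have := isProbabilityMeasure_eventLaw hμ hν.le
  have := isProbabilityMeasure_inputLaw (μ := μ) (ν := ν)
  have hQ := Measure.isProbabilityMeasure_map (μ := inputLaw μ ν) (measurable_past n).aemeasurable
  have hm : Measurable fun ω : Input => (past n ω, ω.2 n) :=
    (measurable_past n).prodMk ((measurable_pi_apply n).comp measurable_snd)
  have hR := measurable_gapReward (μ := μ) (ν := ν) N e₀ S n
  have hA := integrable_gapAvail N e₀ S hμ hν n
  have hf := integrable_valueFun_energyLevel N e₀ S hμ hν he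
  have hd : Integrable (fun ω => valueFun μ ν N (energyLevel N e₀ S ω (n + 1)) -
      valueFun μ ν N (energyLevel N e₀ S ω n)) (inputLaw μ ν) := (hf (n + 1)).sub (hf n)
  have hint : Integrable (gapReward μ ν N e₀ S n)
      (((inputLaw μ ν).map (past n)).prod (eventLaw μ ν)) := by
    rw [← map_past_point_inputLaw, integrable_map_measure hR.aestronglyMeasurable hm.aemeasurable]
    refine (hA.add hd).congr (ae_of_all _ fun ω => ?_)
    exact (gapReward_past_point N e₀ S n ω).symm
  refine ⟨(inputLaw μ ν).map (past n), hQ, hint.integral_prod_left, ?_⟩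
  rw [← integral_prod _ hint, ← map_past_point_inputLaw,
    integral_map hm.aemeasurable hR.aestronglyMeasurable,
    integral_congr_ae (ae_of_all _ (gapReward_past_point N e₀ S n)),
    integral_add hA hd, integral_sub (hf (n + 1)) (hf n)]

/-- Mean time available before the `n`-th point. -/
noncomputable def meanAvail (μ ν : ℝ) (N e₀ : ℕ) (S : Strategy) (n : ℕ) : ℝ :=
  ∑ i ∈ Finset.range n, ∫ ω, gapAvail N e₀ S i ω ∂(inputLaw μ ν)

theorem meanAvail_le (hμ : 0 < μ) (hν : 0 < ν) (he : e₀ ≤ N) (n : ℕ) :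
    meanAvail μ ν N e₀ S n ≤
      n * (chainAvailability N (μ / ν) / (μ + ν)) + valueFun μ ν N e₀ := by
  have := isProbabilityMeasure_eventLaw hμ hν.le
  have := isProbabilityMeasure_inputLaw (μ := μ) (ν := ν)
  have h : meanAvail μ ν N e₀ S n +
      ∫ ω, valueFun μ ν N (energyLevel N e₀ S ω n) ∂(inputLaw μ ν) ≤
      n * (chainAvailability N (μ / ν) / (μ + ν)) + valueFun μ ν N e₀ := by
    induction n with
    | zero => simp [meanAvail, energyLevel]
    | succ n ih =>
      obtain ⟨Q, hQ, hint, hn⟩ := integral_gapAvail_add N e₀ S hμ hν he n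
      have h1 := integral_mono hint (integrable_const _)
        (integral_gapReward_le N e₀ S hμ hν he n)
      rw [← hn, integral_const, probReal_univ, one_smul] at h1
      rw [meanAvail] at ih ⊢
      rw [Finset.sum_range_succ]
      push_cast
      linarith
  have h0 := integral_nonneg (μ := inputLaw μ ν)
    (f := fun ω => valueFun μ ν N (energyLevel N e₀ S ω n)) fun ω => valueFun_nonneg hμ hν N _
  linarith

/-- Telescoping is exact here; the error is a difference of two means of `valueFun`, both between
`0` and its maximum, hence bounded uniformly in `n`. -/
theorem abs_meanAvail_sub_le (hμ : 0 < μ) (hν : 0 < ν) (he : e₀ ≤ N)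
    (hS : ∀ n q, S.isOn n q = true) (n : ℕ) :
    |meanAvail μ ν N e₀ S n - n * (chainAvailability N (μ / ν) / (μ + ν))| ≤
      valueFun μ ν N N := by
  have := isProbabilityMeasure_eventLaw hμ hν.le
  have := isProbabilityMeasure_inputLaw (μ := μ) (ν := ν)
  have h : meanAvail μ ν N e₀ S n +
      ∫ ω, valueFun μ ν N (energyLevel N e₀ S ω n) ∂(inputLaw μ ν) =
      n * (chainAvailability N (μ / ν) / (μ + ν)) + valueFun μ ν N e₀ := by
    induction n with
    | zero => simp [meanAvail, energyLevel]
    | succ n ih =>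
      obtain ⟨Q, hQ, hint, hn⟩ := integral_gapAvail_add N e₀ S hμ hν he n
      simp_rw [integral_gapReward_of_isOn N e₀ S hμ hν he hS n] at hn
      rw [integral_const, probReal_univ, one_smul] at hn
      rw [meanAvail] at ih ⊢
      rw [Finset.sum_range_succ]
      push_cast
      linarith
  have h0 := integral_nonneg (μ := inputLaw μ ν)
    (f := fun ω => valueFun μ ν N (energyLevel N e₀ S ω n)) fun ω => valueFun_nonneg hμ hν N _
  have h1 := integral_mono (integrable_valueFun_energyLevel N e₀ S hμ hν he n)
    (integrable_const (valueFun μ ν N N)) fun ω =>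
      valueFun_le hμ hν (energyLevel_le N e₀ S he ω n)
  rw [integral_const, probReal_univ, one_smul] at h1
  have h2 := valueFun_nonneg hμ hν N e₀
  have h3 := valueFun_le hμ hν he
  rw [abs_le]
  constructor <;> linarith

end Gap

end SelfPoweredHetNet

namespace SelfPoweredHetNet

/-! ### Long-run availability -/

section LongRun

variable {μ ν : ℝ}

theorem tendsto_integral_abs_eventTime_div (hμ : 0 < μ) (hν : 0 < ν) :
    Tendsto (fun n : ℕ => ∫ ω, |(n : ℝ)⁻¹ * eventTime ω n - 1 / (μ + ν)| ∂(inputLaw μ ν))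
      atTop (𝓝 0) := by
  have := isProbabilityMeasure_eventLaw hμ hν.le
  have := isProbabilityMeasure_inputLaw (μ := μ) (ν := ν)
  have hind : Pairwise fun i j => IndepFun (fun ω : Input => (ω.2 i).1)
      (fun ω : Input => (ω.2 j).1) (inputLaw μ ν) := by
    intro i j hij
    have h1 : iIndepFun (fun (i : ℕ) (x : ℕ → ℝ × Bool) => (x i).1)
        (Measure.infinitePi fun _ : ℕ => eventLaw μ ν) :=
      iIndepFun_infinitePi (P := fun _ : ℕ => eventLaw μ ν) (X := fun _ x => x.1)
        fun _ => measurable_fst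
    -- The gaps do not involve the seed, so independence is pulled back along the second projection.
    have h2 : (inputLaw μ ν).map Prod.snd = Measure.infinitePi fun _ : ℕ => eventLaw μ ν := by
      rw [inputLaw, Measure.map_snd_prod, measure_univ, one_smul]
    have h3 := h1.indepFun hij
    rw [← h2] at h3
    have hi : ∀ i, Measurable fun x : ℕ → ℝ × Bool => (x i).1 := fun i => by fun_prop
    rw [indepFun_iff_measure_inter_preimage_eq_mul] at h3 ⊢
    intro s t hs ht
    have h4 := h3 s t hs ht
    rwa [Measure.map_apply measurable_snd ((hi i hs).inter (hi j ht)),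
      Measure.map_apply measurable_snd (hi i hs), Measure.map_apply measurable_snd (hi j ht)] at h4
  have hid : ∀ i, IdentDistrib (fun ω : Input => (ω.2 i).1) (fun ω : Input => (ω.2 0).1)
      (inputLaw μ ν) (inputLaw μ ν) := fun i =>
    ⟨(measurable_gap i).aemeasurable, (measurable_gap 0).aemeasurable, by
      rw [map_gap_inputLaw hμ hν, map_gap_inputLaw hμ hν]⟩
  have h := strong_law_Lp le_rfl ENNReal.one_ne_top (fun i (ω : Input) => (ω.2 i).1)
    (memLp_one_iff_integrable.2 (integrable_gap hμ hν 0)) hind hid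
  have h' := (ENNReal.tendsto_toReal ENNReal.zero_ne_top).comp h
  refine h'.congr fun n => ?_
  have hm : Measurable fun ω : Input => (n : ℝ)⁻¹ * eventTime ω n - 1 / (μ + ν) :=
    ((measurable_eventTime n).const_mul _).sub_const _
  rw [Function.comp_apply, integral_gap hμ hν, eLpNorm_one_eq_lintegral_enorm]
  exact (integral_norm_eq_lintegral_enorm hm.aestronglyMeasurable).symm

variable (N e₀ : ℕ) (S : Strategy)

theorem integral_availableAt [IsProbabilityMeasure (inputLaw μ ν)] {T : ℝ} (hT : 0 ≤ T) :
    ∫ t in (0 : ℝ)..T, (inputLaw μ ν).real {ω | AvailableAt N e₀ S ω t} =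
      ∫ ω, volume.real (availSet N e₀ S ω ∩ Set.Ico 0 T) ∂(inputLaw μ ν) := by
  have hB := measurableSet_availableAt N e₀ S
  have h1 : ∫⁻ t in Set.Ico 0 T, inputLaw μ ν {ω | AvailableAt N e₀ S ω t} =
      ∫⁻ ω, volume (availSet N e₀ S ω ∩ Set.Ico 0 T) ∂(inputLaw μ ν) := by
    have h2 := Measure.prod_apply_symm (μ := inputLaw μ ν)
      (ν := volume.restrict (Set.Ico 0 T)) hB
    rw [Measure.prod_apply hB] at h2
    refine h2.symm.trans (lintegral_congr fun ω => ?_)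
    exact Measure.restrict_apply (measurableSet_availSet N e₀ S ω)
  rw [intervalIntegral.integral_of_le hT, ← Measure.restrict_congr_set Ico_ae_eq_Ioc]
  have hm : Measurable fun t : ℝ => inputLaw μ ν {ω | AvailableAt N e₀ S ω t} :=
    measurable_measure_prodMk_right hB
  have hm' : Measurable fun ω => volume (availSet N e₀ S ω ∩ Set.Ico 0 T) :=
    measurable_measure_prodMk_left (ν := volume)
      (hB.inter (measurable_snd (measurableSet_Ico (a := (0 : ℝ)) (b := T))))
  have e1 := integral_toReal (μ := volume.restrict (Set.Ico 0 T)) hm.aemeasurable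
    (ae_of_all _ fun t => measure_lt_top _ _)
  have e2 := integral_toReal (μ := inputLaw μ ν) hm'.aemeasurable
    (ae_of_all _ fun ω => volume_inter_Ico_lt_top _ 0 T)
  rw [h1] at e1
  exact e1.trans e2.symm

theorem measurable_volume_availSet_inter {g : Input → ℝ} (hg : Measurable g) :
    Measurable fun ω => volume.real (availSet N e₀ S ω ∩ Set.Ico 0 (g ω)) := by
  have h : MeasurableSet {q : Input × ℝ | AvailableAt N e₀ S q.1 q.2 ∧ 0 ≤ q.2 ∧ q.2 < g q.1} :=
    (measurableSet_availableAt N e₀ S).inter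
      ((measurableSet_le measurable_const measurable_snd).inter
        (measurableSet_lt measurable_snd (hg.comp measurable_fst)))
  exact (measurable_measure_prodMk_left (ν := volume) h).ennreal_toReal

theorem integrable_eventTime (hμ : 0 < μ) (hν : 0 < ν) (n : ℕ) :
    Integrable (fun ω => eventTime ω n) (inputLaw μ ν) :=
  integrable_finsetSum _ fun i _ => integrable_gap hμ hν i

/-- The time available before a cutoff is 1-Lipschitz in the cutoff. Moving from `T` to the `n`-th
point costs a deterministic error through `n / (μ + ν)` and an L¹ fluctuation. -/
theorem abs_integral_availableAt_sub_meanAvail_le (hμ : 0 < μ) (hν : 0 < ν) {T : ℝ} (hT : 0 ≤ T)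
    (n : ℕ) :
    |(∫ t in (0 : ℝ)..T, (inputLaw μ ν).real {ω | AvailableAt N e₀ S ω t}) -
        meanAvail μ ν N e₀ S n| ≤
      |T - n / (μ + ν)| +
        n * ∫ ω, |(n : ℝ)⁻¹ * eventTime ω n - 1 / (μ + ν)| ∂(inputLaw μ ν) := by
  have := isProbabilityMeasure_eventLaw hμ hν.le
  have := isProbabilityMeasure_inputLaw (μ := μ) (ν := ν)
  have hTn := integrable_eventTime hμ hν n
  have hae := ae_gap_nonneg hμ hν
  have hA : Integrable (fun ω => volume.real (availSet N e₀ S ω ∩ Set.Ico 0 T))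
      (inputLaw μ ν) := by
    refine Integrable.of_bound
      (measurable_volume_availSet_inter N e₀ S measurable_const).aestronglyMeasurable T
      (ae_of_all _ fun ω => ?_)
    rw [Real.norm_of_nonneg measureReal_nonneg]
    simpa using volume_real_inter_Ico_le (availSet N e₀ S ω) hT
  have hG : Integrable (fun ω => ∑ i ∈ Finset.range n, gapAvail N e₀ S i ω) (inputLaw μ ν) :=
    integrable_finsetSum _ fun i _ => integrable_gapAvail N e₀ S hμ hν i
  have hW : meanAvail μ ν N e₀ S n =
      ∫ ω, ∑ i ∈ Finset.range n, gapAvail N e₀ S i ω ∂(inputLaw μ ν) :=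
    (integral_finsetSum _ fun i _ => integrable_gapAvail N e₀ S hμ hν i).symm
  have hR : Integrable (fun ω => |(n : ℝ)⁻¹ * eventTime ω n - 1 / (μ + ν)|) (inputLaw μ ν) :=
    ((hTn.const_mul _).sub (integrable_const _)).abs
  have hbound : ∀ᵐ ω ∂(inputLaw μ ν),
      |volume.real (availSet N e₀ S ω ∩ Set.Ico 0 T) -
        ∑ i ∈ Finset.range n, gapAvail N e₀ S i ω| ≤
      |T - n / (μ + ν)| + n * |(n : ℝ)⁻¹ * eventTime ω n - 1 / (μ + ν)| := by
    filter_upwards [hae] with ω hω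
    rw [← volume_availSet_inter_eventTime N e₀ S hω n]
    refine (abs_volume_real_inter_Ico_sub_le _ hT (eventTime_nonneg hω n)).trans ?_
    have h1 : (n : ℝ) * |(n : ℝ)⁻¹ * eventTime ω n - 1 / (μ + ν)| =
        |n / (μ + ν) - eventTime ω n| := by
      rcases Nat.eq_zero_or_pos n with rfl | hn
      · simp [eventTime]
      · have hn' : (n : ℝ) ≠ 0 := by positivity
        rw [abs_sub_comm (n / (μ + ν)), ← abs_of_nonneg (Nat.cast_nonneg n : (0 : ℝ) ≤ n),
          ← abs_mul, abs_of_nonneg (Nat.cast_nonneg n : (0 : ℝ) ≤ n), mul_sub,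
          mul_inv_cancel_left₀ hn', mul_one_div]
    rw [h1]
    exact abs_sub_le _ _ _
  rw [integral_availableAt N e₀ S hT, hW, ← integral_sub hA hG]
  refine abs_integral_le_integral_abs.trans ?_
  refine (integral_mono_ae (hA.sub hG).abs ((integrable_const _).add (hR.const_mul _))
    hbound).trans ?_
  rw [integral_add' (integrable_const _) (hR.const_mul _), integral_const, probReal_univ, one_smul,
    integral_const_mul]

theorem tendsto_floor_div (hμ : 0 < μ) (hν : 0 < ν) :
    Tendsto (fun T : ℝ => (⌊(μ + ν) * T⌋₊ : ℝ) / T) atTop (𝓝 (μ + ν)) :=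
  tendsto_nat_floor_mul_div_atTop (add_pos hμ hν).le

/-- About `(μ + ν) * T` points occur before `T`; with the integer part of this as `n`, both errors
are `o(T)`. -/
theorem tendsto_integral_availableAt_sub_meanAvail (hμ : 0 < μ) (hν : 0 < ν) :
    Tendsto (fun T : ℝ => (1 / T) *
      ((∫ t in (0 : ℝ)..T, (inputLaw μ ν).real {ω | AvailableAt N e₀ S ω t}) -
        meanAvail μ ν N e₀ S ⌊(μ + ν) * T⌋₊)) atTop (𝓝 0) := by
  have hβ : 0 < μ + ν := add_pos hμ hν
  have hfl := tendsto_floor_div hμ hν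
  have hε := (tendsto_integral_abs_eventTime_div hμ hν).comp
    (tendsto_nat_floor_atTop.comp (tendsto_id.const_mul_atTop hβ))
  have hlim := ((hfl.div_const (μ + ν)).const_sub 1).abs.add (hfl.mul hε)
  rw [div_self hβ.ne', sub_self, abs_zero, mul_zero, add_zero] at hlim
  refine squeeze_zero_norm' ?_ hlim
  filter_upwards [eventually_gt_atTop 0] with T hT
  have h := abs_integral_availableAt_sub_meanAvail_le N e₀ S hμ hν hT.le ⌊(μ + ν) * T⌋₊
  rw [Real.norm_eq_abs, abs_mul, abs_of_pos (one_div_pos.2 hT)]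
  refine (mul_le_mul_of_nonneg_left h (one_div_pos.2 hT).le).trans (le_of_eq ?_)
  rw [mul_add, ← abs_of_pos (one_div_pos.2 hT), ← abs_mul, abs_of_pos (one_div_pos.2 hT)]
  congr 1
  · congr 1
    field_simp
  · simp only [Function.comp_apply, id]
    ring

/-- No strategy is available for more than the fraction of time the policy always ON is. -/
theorem HasAvailability.le {r : ℝ} (hμ : 0 < μ) (hν : 0 < ν) (he : e₀ ≤ N)
    (h : HasAvailability μ ν N e₀ S r) : r ≤ chainAvailability N (μ / ν) := by
  have hβ : 0 < μ + ν := add_pos hμ hν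
  have hlim := (tendsto_integral_availableAt_sub_meanAvail N e₀ S hμ hν).add
    (((tendsto_floor_div hμ hν).mul_const (chainAvailability N (μ / ν) / (μ + ν))).add
      (tendsto_inv_atTop_zero.mul_const (valueFun μ ν N e₀)))
  rw [mul_div_cancel₀ _ hβ.ne', zero_mul, add_zero, zero_add] at hlim
  refine le_of_tendsto_of_tendsto h hlim ?_
  filter_upwards [eventually_gt_atTop 0] with T hT
  have hW := mul_le_mul_of_nonneg_left (meanAvail_le N e₀ S hμ hν he ⌊(μ + ν) * T⌋₊)
    (inv_pos.2 hT).le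
  rw [one_div, mul_sub, div_eq_inv_mul (⌊(μ + ν) * T⌋₊ : ℝ) T]
  rw [mul_add, ← mul_assoc] at hW
  linarith

theorem HasAvailability.nonneg {r : ℝ} (h : HasAvailability μ ν N e₀ S r) : 0 ≤ r := by
  refine ge_of_tendsto h ?_
  filter_upwards [eventually_gt_atTop 0] with T hT
  exact mul_nonneg (one_div_pos.2 hT).le
    (intervalIntegral.integral_nonneg hT.le fun _ _ => measureReal_nonneg)

theorem hasAvailability_of_isOn (hμ : 0 < μ) (hν : 0 < ν) (he : e₀ ≤ N)
    (hS : ∀ n q, S.isOn n q = true) :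
    HasAvailability μ ν N e₀ S (chainAvailability N (μ / ν)) := by
  have hβ : 0 < μ + ν := add_pos hμ hν
  have hrem : Tendsto (fun T : ℝ => T⁻¹ * (meanAvail μ ν N e₀ S ⌊(μ + ν) * T⌋₊ -
      ⌊(μ + ν) * T⌋₊ * (chainAvailability N (μ / ν) / (μ + ν)))) atTop (𝓝 0) := by
    have h0 := tendsto_inv_atTop_zero.mul_const (valueFun μ ν N N)
    rw [zero_mul] at h0
    refine squeeze_zero_norm' ?_ h0
    filter_upwards [eventually_gt_atTop 0] with T hT
    rw [norm_mul, Real.norm_of_nonneg (inv_pos.2 hT).le]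
    exact mul_le_mul_of_nonneg_left (abs_meanAvail_sub_le N e₀ S hμ hν he hS _) (inv_pos.2 hT).le
  have hlim := (tendsto_integral_availableAt_sub_meanAvail N e₀ S hμ hν).add
    (((tendsto_floor_div hμ hν).mul_const (chainAvailability N (μ / ν) / (μ + ν))).add hrem)
  rw [mul_div_cancel₀ _ hβ.ne', add_zero, zero_add] at hlim
  refine hlim.congr fun T => ?_
  ring

end LongRun

/-! ### Thinned strategies -/

/-- The strategy which is always ON with probability `q`, and otherwise never. -/
noncomputable def thinned (q : unitInterval) : Strategy where
  isOn n p := decide (p.1 ≤ q)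
  measurable_isOn n := by
    refine measurable_to_bool ?_
    have : (fun p : unitInterval × (Fin n → ℝ × Bool) × ℝ => decide (p.1 ≤ q)) ⁻¹' {true} =
        Prod.fst ⁻¹' Set.Iic q := by
      ext p
      simp
    rw [this]
    exact measurable_fst measurableSet_Iic

theorem thinned_one_isOn (n : ℕ) (p : unitInterval × (Fin n → ℝ × Bool) × ℝ) :
    (thinned 1).isOn n p = true := by
  simpa [thinned] using unitInterval.le_one' (t := p.1)

variable (N e₀ : ℕ)

theorem thinned_state (q : unitInterval) (ω : Input) (n : ℕ) (s : ℝ) :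
    (thinned q).state ω n s = decide (ω.1 ≤ q) := rfl

/-- The seed matters only through `ω.1 ≤ q`; on that event the trajectory is the always-ON one.
Hence availability is a product event, and its probability scales by `q`. -/
theorem energyLevel_thinned {q : unitInterval} {ω ω' : Input} (h : ω.1 ≤ q) (h2 : ω.2 = ω'.2)
    (n : ℕ) : energyLevel N e₀ (thinned q) ω n = energyLevel N e₀ (thinned 1) ω' n := by
  induction n with
  | zero => rfl
  | succ n ih =>
    have h1 : ω'.1 ≤ 1 := unitInterval.le_one'
    simp only [energyLevel, ih, thinned_state, h, h1, h2]

theorem availableAt_thinned {q : unitInterval} {ω : Input} {t : ℝ} :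
    AvailableAt N e₀ (thinned q) ω t ↔
      ω.1 ≤ q ∧ AvailableAt N e₀ (thinned 1) (1, ω.2) t := by
  by_cases h : ω.1 ≤ q
  · simp [AvailableAt, thinned_state, h, energyLevel_thinned N e₀ (ω' := (1, ω.2)) h rfl, eventTime]
  · simp [AvailableAt, thinned_state, h]

theorem inputLaw_real_thinned {μ ν : ℝ} [IsProbabilityMeasure (eventLaw μ ν)]
    (q : unitInterval) (t : ℝ) :
    (inputLaw μ ν).real {ω | AvailableAt N e₀ (thinned q) ω t} =
      q * (Measure.infinitePi fun _ : ℕ => eventLaw μ ν).real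
        {x | AvailableAt N e₀ (thinned 1) (1, x) t} := by
  have hset : {ω | AvailableAt N e₀ (thinned q) ω t} =
      Set.Iic q ×ˢ {x | AvailableAt N e₀ (thinned 1) (1, x) t} := by
    ext ω
    exact availableAt_thinned N e₀
  rw [hset, inputLaw, measureReal_def, Measure.prod_prod, ENNReal.toReal_mul]
  congr 1
  rw [unitInterval.volume_Iic, ENNReal.toReal_ofReal q.2.1]

theorem hasAvailability_thinned {μ ν : ℝ} (hμ : 0 < μ) (hν : 0 < ν) (he : e₀ ≤ N)
    (q : unitInterval) :
    HasAvailability μ ν N e₀ (thinned q) (q * chainAvailability N (μ / ν)) := by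
  have := isProbabilityMeasure_eventLaw hμ hν.le
  have h := (hasAvailability_of_isOn N e₀ (thinned 1) hμ hν he thinned_one_isOn).const_mul (q : ℝ)
  refine h.congr fun T => ?_
  simp_rw [inputLaw_real_thinned]
  rw [intervalIntegral.integral_const_mul, intervalIntegral.integral_const_mul]
  simp only [Set.Icc.coe_one, one_mul]
  ring

/-- Every availability up to the one of the policy which is always ON can be realized. -/
theorem exists_hasAvailability {μ ν r : ℝ} (hμ : 0 < μ) (hν : 0 < ν) {N e₀ : ℕ} (hN : 0 < N)
    (he : e₀ ≤ N) (hr : 0 ≤ r) (hrg : r ≤ chainAvailability N (μ / ν)) :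
    ∃ S, HasAvailability μ ν N e₀ S r := by
  have hpos := chainAvailability_pos (div_pos hμ hν) hN
  have h := hasAvailability_thinned N e₀ hμ hν he
    ⟨r / chainAvailability N (μ / ν), div_nonneg hr hpos.le, (div_le_one hpos).2 hrg⟩
  rw [div_mul_cancel₀ _ hpos.ne'] at h
  exact ⟨_, h⟩

/-- The strategy which is never ON. -/
def neverOn : Strategy := ⟨fun _ _ => false, fun _ => measurable_const⟩

theorem hasAvailability_neverOn (μ ν : ℝ) : HasAvailability μ ν N e₀ neverOn 0 := by
  have h : ∀ t, {ω | AvailableAt N e₀ neverOn ω t} = ∅ := by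
    intro t
    ext ω
    simp [AvailableAt, Strategy.state, neverOn]
  simp [HasAvailability, h]

/-! ### The availability region -/

variable {K : ℕ} (net : HetNet K)

theorem exists_tierAchieves_iff {e₀ : Fin K → ℕ} (he₀ : ∀ k, e₀ k ≤ net.capacity k)
    {ρ : Fin K → ℝ} (hρ : ∀ j, 0 ≤ ρ j) (k : Fin K) :
    (∃ S, TierAchieves net e₀ ρ k S) ↔ ρ k ≤ gFun net k ρ := by
  have hμ := net.harvestRate_pos k
  rcases (loadSum_nonneg net hρ).eq_or_lt with hL | hL
  -- With zero load the utilization rate is only a default value; `neverOn` has availability zero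
  -- for every rate, so that value is irrelevant.
  · have hk : ρ k = 0 := le_antisymm (not_lt.1 fun h => (loadSum_pos net hρ h).ne hL) (hρ k)
    have hg : gFun net k ρ = 0 := by
      have : gFun net k ρ = chainAvailability (net.capacity k) (net.harvestRate k *
        loadSum net ρ / (net.coverage * net.userDensity * weight net k)) := rfl
      rw [this, ← hL, mul_zero, zero_div, chainAvailability_zero]
    rw [hk, hg]
    refine iff_of_true ⟨neverOn, ?_⟩ le_rfl
    rw [TierAchieves, hk]
    exact hasAvailability_neverOn _ _ _ _
  · have hν := utilizationRate_pos net hρ hL k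
    rw [gFun_eq net hρ hL]
    constructor
    · rintro ⟨S, hS⟩
      exact HasAvailability.le _ _ S hμ hν (he₀ k) hS
    · exact exists_hasAvailability hμ hν (net.capacity_pos k) (he₀ k) (hρ k)

end SelfPoweredHetNet

open SelfPoweredHetNet in
theorem mainTheorem1 {K : ℕ} (net : HetNet K) (e₀ : Fin K → ℕ) (he₀ : ∀ k, e₀ k ≤ net.capacity k) :
    (∀ (ρ : Fin K → ℝ) (k : Fin K), (∀ j, j ≠ k → 0 ≤ ρ j) →
      IsGreatest (tierSolutions net k ρ) (rhoStar net k ρ) ∧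
      (∀ x ∈ tierSolutions net k ρ, 0 < x → x = rhoStar net k ρ) ∧
      IsGreatest {x : ℝ | ∃ S : Strategy, TierAchieves net e₀ (Function.update ρ k x) k S}
        (rhoStar net k ρ)) ∧
    availabilityRegion net e₀ = {ρ | ∀ k, 0 ≤ ρ k ∧ ρ k ≤ rhoStar net k ρ} := by
  constructor
  · intro ρ k hρ
    obtain ⟨hgr, huniq⟩ := isGreatest_rhoStar net hρ
    have hiff : ∀ x, 0 ≤ x → ((∃ S, TierAchieves net e₀ (Function.update ρ k x) k S) ↔
        x ≤ rhoStar net k ρ) := by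
      intro x hx
      rw [exists_tierAchieves_iff net he₀ (update_nonneg hρ hx), Function.update_self,
        le_rhoStar_iff net hρ hx]
    refine ⟨hgr, huniq, (hiff _ hgr.1.1).2 le_rfl, fun x hx => ?_⟩
    -- The equivalence needs `0 ≤ x`; a negative `x` is below `rhoStar net k ρ` anyway, which is
    -- nonnegative.
    rcases le_total 0 x with h | h
    · exact (hiff x h).1 hx
    · exact h.trans hgr.1.1
  · have hiff : ∀ ρ : Fin K → ℝ, (∀ j, 0 ≤ ρ j) → ∀ k,
        ((∃ S, TierAchieves net e₀ ρ k S) ↔ ρ k ≤ rhoStar net k ρ) := by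
      intro ρ hρ k
      rw [exists_tierAchieves_iff net he₀ hρ, le_rhoStar_iff net (fun j _ => hρ j) (hρ k),
        Function.update_eq_self]
    ext ρ
    rw [availabilityRegion, Set.mem_iUnion]
    constructor
    · rintro ⟨S, hS⟩
      -- Nonnegativity must come first, straight from the limit of averaged probabilities: the
      -- formula for the utilization rate is only available afterwards.
      have hρ : ∀ j, 0 ≤ ρ j := fun j => HasAvailability.nonneg _ _ _ (hS j)
      exact fun k => ⟨hρ k, (hiff ρ hρ k).1 ⟨S k, hS k⟩⟩
    · intro h
      choose S hS using fun k => (hiff ρ (fun j => (h j).1) k).2 (h k).2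
      exact ⟨S, hS⟩
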